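/- **Setting.** Let $G$ be a torsion-free abelian group with a translation-invariant partial order $\le$, let $G_+=\{g\in G: 0\le g\}$, and let $E\subseteq G$ be a maximal ($\mathbb Z$-linearly) independent set. For $g\in G$ there are an integer $q>0$ and a finitely supported $p\colon E\to\mathbb Z$ with $qg=\sum_{a\in E}p(a)a$; put $\varphi(g)=p/q\in\bigoplus_E\mathbb Q\subseteq\bigoplus_E\mathbb R$, and let $C=\operatorname{conv}(\varphi[G_+])\subseteq\bigoplus_E\mathbb R$. A *linear order extension* of $\le$ is a translation-invariant total order on $G$ that contains $\le$. Call a subset $M$ of a real vector space open if $\{\lambda\in\mathbb R:\lambda x+(1-\lambda)y\in M\}$ is open in $\mathbb R$ for all $x\in M$ and all vectors $y$; boundary $\partial$ and interior are taken in this topology. For a linear vector space order $\preceq$ on $\bigoplus_E\mathbb R$ and a vector $a$, with $|a|=\max(a,-a)$, let $$V_a=\operatorname{span}\{x: 0\preceq x\preceq |a|\},\qquad H_a=\operatorname{span}\{x\succeq 0: nx\preceq |a|\text{ for all }n\in\mathbb Z\},$$ and let $(V_a)_+,(H_a)_+$ be their sets of elements $\succeq 0$. A set $U\subseteq\bigoplus_E\mathbb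 Q\setminus\{0\}$ is *generating* for $\preceq$ if every nonzero vector of $\bigoplus_E\mathbb R$ lies in $V_a$ for some $a\in U$. The linear vector space orders on $V_a$ *defined by the linearly ordered hyperplane* $H_a$ are those with positive cone $(H_a)_+\cup\{h+tb: h\in H_a,\ t>0\}$, where $b\in V_a\setminus H_a$. Such an order is an *extension on $V_a$* if its positive cone contains $C\cap V_a$. **Theorem.** 1. For every linear order extension $\le'$ of $\le$ there are a linear vector space order $\preceq$ on $\bigoplus_E\mathbb R$ such that $g\le' h\iff\varphi(g)\preceq\varphi(h)$ for all $g,h\in G$, and a set $U\subseteq\bigoplus_E\mathbb Q\setminus\{0\}$ which is generating for $\preceq$. 2. Let $\le'$ be a linear order extension of $\le$, and let $\preceq$ and $U$ be any linear vector space order and generating set as in 1. Then $\le'$ is described by the linearly ordered hyperplanes $H_a$, $a\in U$, and the signs of the $a\in U$: for all $g,h\in G$ we have $g\le' h$ if and only if $g=h$ or $$\varphi(h)-\varphi(g)\in (H_a)_+\cup\{x+t|a|: x\in H_a,\ t>0\}\quad\text{for some }a\in U.$$ Moreover, for each $a\in U$: $V_a=H_a\oplus\mathbb R a$ with $a\notin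 H_a$; $H_a$ is linearly ordered by $(H_a)_+$; $(V_a)_+=(H_a)_+\cup\{x+t|a|: x\in H_a,\ t>0\}$; $$C\cap H_a\subseteq (H_a)_+\cap\partial C;\tag{$*$}$$ and the number of extensions on $V_a$ defined by the linearly ordered hyperplane $H_a$ is exactly one if $(V_a\cap\varphi[G_+])\setminus H_a$ is non-empty, and exactly two otherwise. 3. Conversely, let $\preceq$ be a linear vector space order on $\bigoplus_E\mathbb R$ and $U$ a generating set for $\preceq$ such that $(*)$ holds for every $a\in U$. Assume that $C$ has non-empty interior or that, for every $a\in U$, the set $(V_a\cap\varphi[G_+])\setminus H_a$ consists only of elements $\succ 0$ or only of elements $\prec 0$. Then there is a linear vector space order $\preceq'$ on $\bigoplus_E\mathbb R$ which has, for every $a\in U$, the same $V_a$, $H_a$ and $(H_a)_+$ as $\preceq$, and for which $g\le' h:\iff\varphi(g)\preceq'\varphi(h)$ defines a linear order extension of $\le$ on $G$. -/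

import Mathlib

noncomputable section

/-! ### Orders on groups -/

/-- `r` is a linear (total) order on the abelian group `G` which is compatible with the addition
and extends the given order `≤` of `G`. -/
structure IsLinearOrderExtension {G : Type*} [AddCommGroup G] [PartialOrder G]
    (r : G → G → Prop) : Prop where
  refl : ∀ x, r x x
  trans : ∀ x y z, r x y → r y z → r x z
  antisymm : ∀ x y, r x y → r y x → x = y
  total : ∀ x y, r x y ∨ r y x
  add_right : ∀ x y z, r x y → r (x + z) (y + z)
  extends_le : ∀ x y, x ≤ y → r x y

/-! ### Maximal independent sets and the embedding into the real vector space -/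

/-- `E` is a maximal independent subset of the abelian group `G`. -/
def IsMaximalIndependent {G : Type*} [AddCommGroup G] (E : Set G) : Prop :=
  Maximal (fun s : Set G => LinearIndepOn ℤ id s) E

/-- Every group element has a positive multiple which is an integral combination of elements of
a given maximal independent set. -/
theorem exists_integral_representation {G : Type*} [AddCommGroup G] {E : Set G}
    (hE : IsMaximalIndependent E) (g : G) :
    ∃ qp : ℕ × (E →₀ ℤ), 0 < qp.1 ∧ qp.1 • g = qp.2.sum fun a n => n • (a : G) := by
  classical
  have key : ∃ c : ℤ, c ≠ 0 ∧ c • g ∈ Submodule.span ℤ E := by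
    by_cases hg : g ∈ E
    · exact ⟨1, one_ne_zero, by simpa using Submodule.subset_span hg⟩
    have hdep : ¬ LinearIndepOn ℤ id (insert g E) := fun h =>
      hg (hE.2 h (Set.subset_insert g E) (Set.mem_insert g E))
    obtain ⟨f, hsupp, hsum, hne⟩ := linearDepOn_iff.mp hdep
    rw [Finsupp.mem_supported] at hsupp
    have hfg : f g ≠ 0 := by
      intro h0
      refine linearDepOn_iff.mpr ⟨f, ?_, hsum, hne⟩ hE.1
      rw [Finsupp.mem_supported]
      intro x hx
      refine (hsupp hx).resolve_left ?_
      rintro rfl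
      exact (Finsupp.mem_support_iff.mp hx) h0
    refine ⟨f g, hfg, ?_⟩
    have hmem : g ∈ f.support := Finsupp.mem_support_iff.mpr hfg
    rw [← Finset.insert_erase hmem, Finset.sum_insert (Finset.notMem_erase _ _),
      add_eq_zero_iff_eq_neg] at hsum
    simp only [id] at hsum
    rw [hsum]
    refine neg_mem (sum_mem fun c hc => Submodule.smul_mem _ _ (Submodule.subset_span ?_))
    exact (hsupp (Finset.erase_subset _ _ hc)).resolve_left (Finset.ne_of_mem_erase hc)
  obtain ⟨c, hc, hmem⟩ := key
  have hmem' : ((c.natAbs : ℕ) : ℤ) • g ∈ Submodule.span ℤ E := by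
    rcases Int.natAbs_eq c with h | h
    · rwa [h] at hmem
    · rw [h, neg_smul] at hmem
      exact neg_mem_iff.mp hmem
  have hmem'' : ((c.natAbs : ℕ) : ℤ) • g ∈
      Submodule.span ℤ (Set.range ((↑) : E → G)) := by simpa using hmem'
  obtain ⟨p, hp⟩ := Finsupp.mem_span_range_iff_exists_finsupp.mp hmem''
  refine ⟨(c.natAbs, p), Int.natAbs_pos.mpr hc, ?_⟩
  rw [hp, natCast_zsmul]

/-- The map `φ : G → ⨁_E ℚ`, `g ↦ p / q`, where `q > 0` and `q g = ∑_{a ∈ E} p(a) a`. -/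
def ratEmbedding {G : Type*} [AddCommGroup G] {E : Set G} (hE : IsMaximalIndependent E) (g : G) :
    E →₀ ℚ :=
  ((Classical.choose (exists_integral_representation hE g)).1 : ℚ)⁻¹ •
    (Classical.choose (exists_integral_representation hE g)).2.mapRange Int.cast Int.cast_zero

/-- The inclusion `⨁_E ℚ ⊆ ⨁_E ℝ`. -/
def ratToReal {ι : Type*} (x : ι →₀ ℚ) : ι →₀ ℝ :=
  x.mapRange Rat.cast Rat.cast_zero

/-- The embedding `φ : G → ⨁_E ℝ`. -/
def realEmbedding {G : Type*} [AddCommGroup G] {E : Set G} (hE : IsMaximalIndependent E) (g : G) :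
    E →₀ ℝ :=
  ratToReal (ratEmbedding hE g)

/-- The image `φ[G_+] ⊆ ⨁_E ℝ` of the positive cone of `G`. -/
def positiveImage {G : Type*} [AddCommGroup G] [PartialOrder G] {E : Set G}
    (hE : IsMaximalIndependent E) : Set (E →₀ ℝ) :=
  realEmbedding hE '' {g | 0 ≤ g}

/-- The convex hull `conv(φ[G_+]) ⊆ ⨁_E ℝ`. -/
def positiveHull {G : Type*} [AddCommGroup G] [PartialOrder G] {E : Set G}
    (hE : IsMaximalIndependent E) : Set (E →₀ ℝ) :=
  convexHull ℝ (positiveImage hE)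

/-! ### Boundaries in real vector spaces -/

/-- The topology of a real vector space in which a set is open iff it meets every line through
one of its points in an open set of parameters. -/
def lineTopology (V : Type*) [AddCommGroup V] [Module ℝ V] : TopologicalSpace V where
  IsOpen M := ∀ a ∈ M, ∀ b : V, IsOpen {t : ℝ | t • a + (1 - t) • b ∈ M}
  isOpen_univ := by simp
  isOpen_inter M N hM hN a ha b := (hM a ha.1 b).inter (hN a ha.2 b)
  isOpen_sUnion S hS a _ b := by
    rw [isOpen_iff_mem_nhds]
    rintro s ⟨N, hN, hs⟩
    have h := (hS N hN _ hs (s • a + (1 - s) • b - (a - b))).preimage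
      (show Continuous fun t : ℝ => 1 + t - s by fun_prop)
    refine Filter.mem_of_superset (h.mem_nhds ?_) ?_
    · simpa using hs
    · intro t ht
      refine ⟨N, hN, ?_⟩
      have ht' : (1 + t - s) • (s • a + (1 - s) • b) +
          (1 - (1 + t - s)) • (s • a + (1 - s) • b - (a - b)) ∈ N := ht
      convert ht' using 1
      module

/-- The boundary of a set with respect to `lineTopology`. -/
def lineBoundary {V : Type*} [AddCommGroup V] [Module ℝ V] (C : Set V) : Set V :=
  @frontier V (lineTopology V) C

/-- The interior of a set with respect to `lineTopology`. -/
def lineInterior {V : Type*} [AddCommGroup V] [Module ℝ V] (C : Set V) : Set V :=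
  @interior V (lineTopology V) C

/-! ### Linear orders on real vector spaces and hyperplanes -/

section VectorSpace

variable {V : Type*} [AddCommGroup V] [Module ℝ V]

/-- `P` is the positive cone of a linear vector space order on the linear subspace `W`. -/
structure IsLinearConeOn (W : Submodule ℝ V) (P : Set V) : Prop where
  subset : P ⊆ W
  add_mem : ∀ x ∈ P, ∀ y ∈ P, x + y ∈ P
  smul_mem : ∀ t : ℝ, 0 ≤ t → ∀ x ∈ P, t • x ∈ P
  pure : ∀ x ∈ P, -x ∈ P → x = 0
  total : ∀ x ∈ W, x ∈ P ∨ -x ∈ P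

open Classical in
/-- The absolute value `|x|` for the linear order with positive cone `Q`. -/
def coneAbs (Q : Set V) (x : V) : V := if x ∈ Q then x else -x

/-- `V_a`: the linear hull of all `x` with `0 ≤ x ≤ |a|`, for the order with positive cone `Q`. -/
def orderSubspace (Q : Set V) (a : V) : Submodule ℝ V :=
  Submodule.span ℝ {x | x ∈ Q ∧ coneAbs Q a - x ∈ Q}

/-- `H_a`: the linear hull of all `x ≥ 0` which are infinitesimal with respect to `|a|`
(i.e. `n x ≤ |a|` for all integers `n`), for the order with positive cone `Q`. -/
def orderHyperplane (Q : Set V) (a : V) : Submodule ℝ V :=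
  Submodule.span ℝ {x | x ∈ Q ∧ ∀ n : ℤ, coneAbs Q a - n • x ∈ Q}

/-- `(H_a)_+`: the positive elements of `H_a`. -/
def hyperplaneCone (Q : Set V) (a : V) : Set V :=
  {x | x ∈ orderHyperplane Q a ∧ x ∈ Q}

/-- `V_a ∩ A \ H_a`. -/
def partOffHyperplane (A Q : Set V) (a : V) : Set V :=
  {x | x ∈ orderSubspace Q a ∧ x ∈ A ∧ x ∉ orderHyperplane Q a}

/-- `H_+ ∪ (H + (ℝ_+ \ {0}) b)`, where `H_+ = P`. -/
def halfSpaceCone (H : Submodule ℝ V) (P : Set V) (b : V) : Set V :=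
  P ∪ {x | ∃ h ∈ H, ∃ t : ℝ, 0 < t ∧ x = h + t • b}

/-- The (positive cones of the) linear orders on the subspace `W` which are defined by the
hyperplane `H` of `W`, linearly ordered with positive cone `P`, and which extend the partial order
with positive cone `C`, restricted to `W`. -/
def extensionsDefinedBy (C : Set V) (W H : Submodule ℝ V) (P : Set V) : Set (Set V) :=
  {R | IsLinearConeOn W R ∧ (∃ b ∈ W, b ∉ H ∧ R = halfSpaceCone H P b) ∧ C ∩ W ⊆ R}

end VectorSpace

/-- For the linear order on `⨁_ι ℝ` with positive cone `Q`, the set `U` consists of nonzero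
rational vectors and the subspaces `V_a` with `a ∈ U` cover `⨁_ι ℝ`. (The vector `0` is covered
as soon as `U` is nonempty; `ι = ∅` and `U = ∅` is allowed.) -/
structure IsGeneratingSet {ι : Type*} (Q : Set (ι →₀ ℝ)) (U : Set (ι →₀ ℚ)) : Prop where
  ne_zero : ∀ a ∈ U, a ≠ 0
  cover : ∀ x : ι →₀ ℝ, x ≠ 0 → ∃ a ∈ U, x ∈ orderSubspace Q (ratToReal a)

/-- The linearly ordered hyperplane `H_a` satisfies `C ∩ H_a ⊆ (H_a)_+ ∩ ∂C`. -/
def BoundaryCondition {V : Type*} [AddCommGroup V] [Module ℝ V] (C Q : Set V) (a : V) : Prop :=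
  C ∩ orderHyperplane Q a ⊆ hyperplaneCone Q a ∩ lineBoundary C

/-- The number (in `ℕ∞`) of linear orders on `V_a` which are defined by the linearly ordered
hyperplane `H_a` and extend the partial order with positive cone `C`, restricted to `V_a`. -/
def numExtensions {V : Type*} [AddCommGroup V] [Module ℝ V] (C Q : Set V) (a : V) : ℕ∞ :=
  (extensionsDefinedBy C (orderSubspace Q a) (orderHyperplane Q a) (hyperplaneCone Q a)).encard

end

/-! For a linear vector space order with cone `Q`, `V_a` consists of the vectors bounded by
multiples of `|a|`, and `H_a` of those infinitesimal relative to `|a|`. A supremum argument gives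
each `x ∈ V_a` a real coefficient of `|a|` modulo `H_a` (`exists_eq_add_smul_coneAbs`). Hence `V_a =
H_a ⊕ ℝ|a|` is ordered lexicographically, and `H_a` with its order leaves only two orders on `V_a`,
one for each sign of `|a|`.

To realise a group order on the real space, consider the cone generated by the image of its
nonnegative elements. If it contained a line, there would be a positive real relation between
rational vectors. A `ℚ`-linear map `ℝ → ℚ` that is positive on the finitely many coefficients turns
it into a positive integer relation (`exists_nat_relation`), which is impossible in a torsion-free
ordered group unless all terms vanish. So the cone is salient, and Zorn's lemma extends it to a
linear order (`exists_isLinearConeOn_top_of_salient`). Injectivity of `φ` and totality give the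
equivalence.

If `C ⊆ Q`, an interior point of `C` in `H_a` could be moved slightly in direction `-|a|` inside
`C`, contradicting positivity. The order with reversed sign extends `C ∩ V_a` exactly when `φ[G_+] ∩
V_a` does not leave `H_a`.

For the converse, if no `V_a` is the whole space, every `V_a` lies in some `H_b`, and the boundary
condition for `b` already gives `C ∩ V_a ⊆ Q`. If some `V_a` is everything, the hypotheses put
`φ[G_+] \ H_a` on one side of `H_a`; at worst the sign above `H_a` is reversed, which changes no
`V_c`, `H_c` or `(H_c)_+` (`halfSpaceCone_congr`). -/

/-! ### Linear vector space orders and the structure of `V_a` and `H_a`. -/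

section Cones

variable {V : Type*} [AddCommGroup V] [Module ℝ V]

namespace IsLinearConeOn

theorem zero_mem {W : Submodule ℝ V} {P : Set V} (hP : IsLinearConeOn W P) : (0 : V) ∈ P := by
  rcases hP.total 0 W.zero_mem with h | h
  · exact h
  · simpa using h

theorem _root_.coneAbs_ne_zero {V : Type*} [AddCommGroup V] (Q : Set V) {a : V} (ha : a ≠ 0) :
    coneAbs Q a ≠ 0 := by
  unfold coneAbs
  split_ifs <;> simpa

variable {Q : Set V} (hQ : IsLinearConeOn ⊤ Q)
include hQ

theorem coneAbs_mem (a : V) : coneAbs Q a ∈ Q := by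
  unfold coneAbs
  split_ifs with h
  · exact h
  · exact (hQ.total a trivial).resolve_left h

/-- Two-sided bounds by multiples of `|a|` are stable under linear operations; conversely, a
positive vector below `t|a|` is scaled into the generating interval by `max t 1`, which avoids
dividing by `t ≤ 0`. -/
theorem mem_orderSubspace_iff {a x : V} :
    x ∈ orderSubspace Q a ↔ ∃ t : ℝ, t • coneAbs Q a - x ∈ Q ∧ t • coneAbs Q a + x ∈ Q := by
  constructor
  · intro hx
    induction hx using Submodule.span_induction with
    | mem x hx =>
      exact ⟨1, by simpa using hx.2, by simpa using hQ.add_mem _ (hQ.coneAbs_mem a) _ hx.1⟩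
    | zero => exact ⟨0, by simpa using hQ.zero_mem, by simpa using hQ.zero_mem⟩
    | add x y _ _ hx hy =>
      obtain ⟨s, hs, hs'⟩ := hx
      obtain ⟨t, ht, ht'⟩ := hy
      refine ⟨s + t, ?_, ?_⟩
      · convert hQ.add_mem _ hs _ ht using 1; module
      · convert hQ.add_mem _ hs' _ ht' using 1; module
    | smul c x _ hx =>
      obtain ⟨s, hs, hs'⟩ := hx
      rcases le_total 0 c with hc | hc
      · refine ⟨c * s, ?_, ?_⟩
        · convert hQ.smul_mem c hc _ hs using 1; module
        · convert hQ.smul_mem c hc _ hs' using 1; module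
      · refine ⟨-c * s, ?_, ?_⟩
        · convert hQ.smul_mem (-c) (neg_nonneg.2 hc) _ hs' using 1; module
        · convert hQ.smul_mem (-c) (neg_nonneg.2 hc) _ hs using 1; module
  · have key : ∀ x ∈ Q, ∀ t : ℝ, t • coneAbs Q a - x ∈ Q → x ∈ orderSubspace Q a := by
      intro x hx t ht
      have hpos : 0 < max t 1 := lt_max_of_lt_right one_pos
      have h1 : (max t 1)⁻¹ • x ∈ orderSubspace Q a := by
        refine Submodule.subset_span ⟨hQ.smul_mem _ (inv_nonneg.2 hpos.le) _ hx, ?_⟩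
        have h2 := hQ.add_mem _ ht _ (hQ.smul_mem (max t 1 - t)
          (sub_nonneg.2 (le_max_left _ _)) _ (hQ.coneAbs_mem a))
        have h3 := hQ.smul_mem _ (inv_nonneg.2 hpos.le) _ h2
        convert h3 using 1
        match_scalars <;> field_simp
        ring
      have h4 := Submodule.smul_mem _ (max t 1) h1
      rwa [smul_inv_smul₀ hpos.ne'] at h4
    rintro ⟨t, h1, h2⟩
    rcases hQ.total x trivial with hx | hx
    · exact key x hx t h1
    · exact neg_mem_iff.1 (key (-x) hx t (by rwa [sub_neg_eq_add]))

/-- Letting `t` run through both signs makes the condition symmetric in `x` and `-x`, so that no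
positivity of `x` is needed. For sums, the bounds at `2t` are averaged. -/
theorem mem_orderHyperplane_iff {a x : V} :
    x ∈ orderHyperplane Q a ↔ ∀ t : ℝ, coneAbs Q a - t • x ∈ Q := by
  constructor
  · intro hx
    induction hx using Submodule.span_induction with
    | mem x hx =>
      intro t
      obtain ⟨n, hn⟩ := exists_int_ge t
      have h1 := hQ.add_mem _ (hx.2 n) _ (hQ.smul_mem (n - t) (sub_nonneg.2 hn) _ hx.1)
      convert h1 using 1
      rw [← Int.cast_smul_eq_zsmul ℝ]
      module
    | zero => intro t; simpa using hQ.coneAbs_mem a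
    | add x y _ _ hx hy =>
      intro t
      have h1 := hQ.smul_mem (1 / 2) (by norm_num) _ (hQ.add_mem _ (hx (2 * t)) _ (hy (2 * t)))
      convert h1 using 1
      module
    | smul c x _ hx => intro t; simpa [smul_smul] using hx (t * c)
  · intro h
    rcases hQ.total x trivial with hx | hx
    · refine Submodule.subset_span ⟨hx, fun n => ?_⟩
      rw [← Int.cast_smul_eq_zsmul ℝ]
      exact h n
    · refine neg_mem_iff.1 (Submodule.subset_span ⟨hx, fun n => ?_⟩)
      rw [← Int.cast_smul_eq_zsmul ℝ, smul_neg, ← neg_smul]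
      exact h _

theorem orderHyperplane_le_orderSubspace (a : V) :
    orderHyperplane Q a ≤ orderSubspace Q a := by
  intro x hx
  rw [hQ.mem_orderHyperplane_iff] at hx
  refine hQ.mem_orderSubspace_iff.2 ⟨1, ?_, ?_⟩
  · simpa using hx 1
  · simpa using hx (-1)

theorem coneAbs_mem_orderSubspace (a : V) : coneAbs Q a ∈ orderSubspace Q a :=
  Submodule.subset_span ⟨hQ.coneAbs_mem a, by simpa using hQ.zero_mem⟩

theorem coneAbs_notMem_orderHyperplane {a : V} (ha : a ≠ 0) :
    coneAbs Q a ∉ orderHyperplane Q a := by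
  intro h
  have h2 := hQ.mem_orderHyperplane_iff.1 h 2
  refine coneAbs_ne_zero Q ha (hQ.pure _ (hQ.coneAbs_mem a) ?_)
  convert h2 using 1
  module

theorem add_smul_coneAbs_mem {a h : V} (hh : h ∈ orderHyperplane Q a) {t : ℝ} (ht : 0 < t) :
    h + t • coneAbs Q a ∈ Q := by
  convert hQ.smul_mem t ht.le _ (hQ.mem_orderHyperplane_iff.1 hh (-t⁻¹)) using 1
  match_scalars <;> field_simp

/-- The coefficient is the supremum of all `s` with `s|a| ≤ x`; completeness of `ℝ` is what makes
the remainder infinitesimal. -/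
theorem exists_eq_add_smul_coneAbs {a x : V} (ha : a ≠ 0) (hx : x ∈ orderSubspace Q a) :
    ∃ h ∈ orderHyperplane Q a, ∃ s : ℝ, x = h + s • coneAbs Q a := by
  obtain ⟨t, ht1, ht2⟩ := hQ.mem_orderSubspace_iff.1 hx
  set b := coneAbs Q a with hb
  have hbQ : b ∈ Q := hQ.coneAbs_mem a
  have hb0 : b ≠ 0 := coneAbs_ne_zero Q ha
  let S : Set ℝ := {s | x - s • b ∈ Q}
  have hdown : ∀ s ∈ S, ∀ r ≤ s, r ∈ S := by
    intro s hs r hr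
    change x - r • b ∈ Q
    convert hQ.add_mem _ hs _ (hQ.smul_mem (s - r) (sub_nonneg.2 hr) _ hbQ) using 1
    module
  have hne : S.Nonempty := ⟨-t, by change x - (-t) • b ∈ Q; convert ht2 using 1; module⟩
  have hbdd : BddAbove S := by
    refine ⟨t, fun s hs => ?_⟩
    by_contra! hlt
    have h1 : -((s - t) • b) ∈ Q := by
      convert hQ.add_mem _ hs _ ht1 using 1
      module
    have h2 := hQ.pure _ (hQ.smul_mem (s - t) (sub_nonneg.2 hlt.le) _ hbQ) h1
    rcases smul_eq_zero.1 h2 with h | h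
    · linarith
    · exact hb0 h
  refine ⟨x - sSup S • b, ?_, sSup S, by module⟩
  refine hQ.mem_orderHyperplane_iff.2 fun r => ?_
  rw [← hb]
  -- For `r < 0` the number `sSup S + r⁻¹` lies in `S`, for `r > 0` it does not; multiplying the
  -- resulting inequality by `|r|` gives the bound.
  rcases lt_trichotomy r 0 with hr | rfl | hr
  · have h1 : sSup S + r⁻¹ < sSup S := by linarith [inv_lt_zero.2 hr]
    obtain ⟨s, hs, hlt⟩ := exists_lt_of_lt_csSup hne h1
    have h2 := hQ.smul_mem (-r) (by linarith) _ (hdown s hs _ hlt.le)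
    convert h2 using 1
    have hr' : r ≠ 0 := hr.ne
    match_scalars
    · field_simp; ring
    · ring
  · simpa using hbQ
  · have h1 : sSup S + r⁻¹ ∉ S := fun h => by
      linarith [le_csSup hbdd h, inv_pos.2 hr]
    have h2 := hQ.smul_mem r hr.le _ ((hQ.total (x - (sSup S + r⁻¹) • b) trivial).resolve_left h1)
    convert h2 using 1
    match_scalars
    · field_simp; ring
    · ring

theorem orderHyperplane_sup_span_coneAbs {a : V} (ha : a ≠ 0) :
    orderHyperplane Q a ⊔ Submodule.span ℝ {coneAbs Q a} = orderSubspace Q a := by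
  refine le_antisymm (sup_le (hQ.orderHyperplane_le_orderSubspace a) ?_) fun x hx => ?_
  · rw [Submodule.span_singleton_le_iff_mem]
    exact hQ.coneAbs_mem_orderSubspace a
  · obtain ⟨h, hh, s, rfl⟩ := hQ.exists_eq_add_smul_coneAbs ha hx
    exact Submodule.add_mem_sup hh (Submodule.smul_mem _ _ (Submodule.mem_span_singleton_self _))

omit hQ in
theorem span_coneAbs (a : V) : Submodule.span ℝ {coneAbs Q a} = Submodule.span ℝ {a} := by
  unfold coneAbs
  split_ifs
  · rfl
  · rw [← Set.neg_singleton, Submodule.span_neg]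

theorem isLinearConeOn_hyperplaneCone (a : V) :
    IsLinearConeOn (orderHyperplane Q a) (hyperplaneCone Q a) where
  subset _ hx := hx.1
  add_mem _ hx _ hy := ⟨AddMemClass.add_mem hx.1 hy.1, hQ.add_mem _ hx.2 _ hy.2⟩
  smul_mem t ht _ hx := ⟨Submodule.smul_mem _ _ hx.1, hQ.smul_mem t ht _ hx.2⟩
  pure _ hx hx' := hQ.pure _ hx.2 hx'.2
  total x hx := (hQ.total x trivial).imp (fun h => ⟨hx, h⟩) fun h => ⟨neg_mem hx, h⟩

theorem orderSubspace_inter_eq_halfSpaceCone {a : V} (ha : a ≠ 0) :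
    (orderSubspace Q a : Set V) ∩ Q =
      halfSpaceCone (orderHyperplane Q a) (hyperplaneCone Q a) (coneAbs Q a) := by
  ext x
  constructor
  · rintro ⟨hxV, hxQ⟩
    obtain ⟨h, hh, s, rfl⟩ := hQ.exists_eq_add_smul_coneAbs ha hxV
    rcases lt_trichotomy s 0 with hs | rfl | hs
    -- A negative coefficient makes `-x` positive as well, so `x = 0`.
    · have h1 := hQ.add_smul_coneAbs_mem (neg_mem hh) (neg_pos.2 hs)
      have h2 := hQ.pure _ hxQ (by convert h1 using 1; module)
      rw [h2]
      exact Or.inl ⟨Submodule.zero_mem _, hQ.zero_mem⟩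
    · exact Or.inl ⟨by simpa using hh, hxQ⟩
    · exact Or.inr ⟨h, hh, s, hs, rfl⟩
  · rintro (hx | ⟨h, hh, t, ht, rfl⟩)
    · exact ⟨hQ.orderHyperplane_le_orderSubspace a hx.1, hx.2⟩
    · exact ⟨AddMemClass.add_mem (hQ.orderHyperplane_le_orderSubspace a hh)
        (Submodule.smul_mem _ _ (hQ.coneAbs_mem_orderSubspace a)), hQ.add_smul_coneAbs_mem hh ht⟩

end IsLinearConeOn

/-! ### Lexicographic cones over an ordered hyperplane. -/

section HalfSpace

variable {H : Submodule ℝ V} {P : Set V} {b : V}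

theorem add_smul_mem_halfSpaceCone_iff (hP : IsLinearConeOn H P) (hb : b ∉ H) {h : V} (hh : h ∈ H)
    {t : ℝ} : h + t • b ∈ halfSpaceCone H P b ↔ 0 < t ∨ t = 0 ∧ h ∈ P := by
  constructor
  · rintro (hx | ⟨k, hk, s, hs, heq⟩)
    · have h1 : t • b ∈ H := by simpa using sub_mem (hP.subset hx) hh
      have ht : t = 0 := by
        by_contra ht
        exact hb ((Submodule.smul_mem_iff _ ht).1 h1)
      subst ht
      exact Or.inr ⟨rfl, by simpa using hx⟩
    · have h1 : (t - s) • b ∈ H := by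
        have : (t - s) • b = k - h := by
          rw [sub_smul, sub_eq_sub_iff_add_eq_add, add_comm, heq]
        rw [this]
        exact sub_mem hk hh
      have ht : t - s = 0 := by
        by_contra ht
        exact hb ((Submodule.smul_mem_iff _ ht).1 h1)
      left
      linarith
  · rintro (ht | ⟨rfl, hx⟩)
    · exact Or.inr ⟨h, hh, t, ht, rfl⟩
    · exact Or.inl (by simpa using hx)

theorem mem_halfSpaceCone_iff_of_mem (hP : IsLinearConeOn H P) (hb : b ∉ H) {h : V} (hh : h ∈ H) :
    h ∈ halfSpaceCone H P b ↔ h ∈ P := by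
  simpa using add_smul_mem_halfSpaceCone_iff hP hb hh (t := 0)

theorem mem_sup_span_singleton_iff {x : V} :
    x ∈ H ⊔ Submodule.span ℝ {b} ↔ ∃ h ∈ H, ∃ t : ℝ, x = h + t • b := by
  rw [Submodule.mem_sup]
  constructor
  · rintro ⟨h, hh, z, hz, rfl⟩
    obtain ⟨t, rfl⟩ := Submodule.mem_span_singleton.1 hz
    exact ⟨h, hh, t, rfl⟩
  · rintro ⟨h, hh, t, rfl⟩
    exact ⟨h, hh, _, Submodule.smul_mem _ _ (Submodule.mem_span_singleton_self _), rfl⟩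

theorem isLinearConeOn_halfSpaceCone (hP : IsLinearConeOn H P) (hb : b ∉ H) :
    IsLinearConeOn (H ⊔ Submodule.span ℝ {b}) (halfSpaceCone H P b) := by
  have hsub : halfSpaceCone H P b ⊆ (H ⊔ Submodule.span ℝ {b} : Submodule ℝ V) := by
    rintro x (hx | ⟨h, hh, t, -, rfl⟩)
    · exact Submodule.mem_sup_left (hP.subset hx)
    · exact mem_sup_span_singleton_iff.2 ⟨h, hh, t, rfl⟩
  refine ⟨hsub, ?_, ?_, ?_, ?_⟩
  · intro x hx y hy
    obtain ⟨h, hh, s, rfl⟩ := mem_sup_span_singleton_iff.1 (hsub hx)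
    obtain ⟨k, hk, t, rfl⟩ := mem_sup_span_singleton_iff.1 (hsub hy)
    rw [show h + s • b + (k + t • b) = (h + k) + (s + t) • b by module,
      add_smul_mem_halfSpaceCone_iff hP hb (add_mem hh hk)]
    rw [add_smul_mem_halfSpaceCone_iff hP hb hh] at hx
    rw [add_smul_mem_halfSpaceCone_iff hP hb hk] at hy
    rcases hx with hs | ⟨rfl, hx⟩ <;> rcases hy with ht | ⟨rfl, hy⟩
    · left; linarith
    · left; linarith
    · left; linarith
    · exact Or.inr ⟨by simp, hP.add_mem _ hx _ hy⟩
  · intro c hc x hx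
    obtain ⟨h, hh, s, rfl⟩ := mem_sup_span_singleton_iff.1 (hsub hx)
    rw [smul_add, smul_smul, add_smul_mem_halfSpaceCone_iff hP hb (Submodule.smul_mem _ _ hh)]
    rw [add_smul_mem_halfSpaceCone_iff hP hb hh] at hx
    rcases hc.eq_or_lt with rfl | hc'
    · exact Or.inr ⟨by simp, by simpa using hP.zero_mem⟩
    · rcases hx with hs | ⟨rfl, hx⟩
      · exact Or.inl (mul_pos hc' hs)
      · exact Or.inr ⟨by simp, hP.smul_mem c hc _ hx⟩
  · intro x hx hx'
    obtain ⟨h, hh, s, rfl⟩ := mem_sup_span_singleton_iff.1 (hsub hx)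
    rw [show -(h + s • b) = -h + (-s) • b by module,
      add_smul_mem_halfSpaceCone_iff hP hb (neg_mem hh)] at hx'
    rw [add_smul_mem_halfSpaceCone_iff hP hb hh] at hx
    rcases hx with hs | ⟨rfl, hx⟩ <;> rcases hx' with ht | ⟨ht, hy⟩
    · linarith
    · linarith
    · linarith
    · simp [hP.pure _ hx hy]
  · intro x hx
    obtain ⟨h, hh, s, rfl⟩ := mem_sup_span_singleton_iff.1 hx
    rw [show -(h + s • b) = -h + (-s) • b by module,
      add_smul_mem_halfSpaceCone_iff hP hb (neg_mem hh),
      add_smul_mem_halfSpaceCone_iff hP hb hh]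
    rcases lt_trichotomy s 0 with hs | rfl | hs
    · right; left; linarith
    · rcases hP.total h hh with h1 | h1 <;> simp [h1]
    · left; left; linarith

/-- Only the side of `H` on which `b` lies matters; this is why `H` defines just two orders. -/
theorem halfSpaceCone_add_smul (P : Set V) {k : V} (hk : k ∈ H) {s : ℝ} (hs : 0 < s) :
    halfSpaceCone H P (k + s • b) = halfSpaceCone H P b := by
  ext x
  refine or_congr Iff.rfl ⟨?_, ?_⟩
  · rintro ⟨h, hh, t, ht, rfl⟩
    exact ⟨h + t • k, add_mem hh (Submodule.smul_mem _ _ hk), t * s, mul_pos ht hs, by module⟩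
  · rintro ⟨h, hh, t, ht, rfl⟩
    refine ⟨h - (t / s) • k, sub_mem hh (Submodule.smul_mem _ _ hk), t / s, div_pos ht hs, ?_⟩
    match_scalars <;> field_simp
    ring

end HalfSpace

end Cones

/-! ### Interior points in the line topology. -/

section LineTopology

variable {V : Type*} [AddCommGroup V] [Module ℝ V] {C : Set V} {x y : V}

theorem lineInterior_subset : lineInterior C ⊆ C :=
  @interior_subset V (lineTopology V) C

theorem exists_add_smul_mem_of_mem_lineInterior (hx : x ∈ lineInterior C) (y : V) :
    ∃ ε : ℝ, 0 < ε ∧ x + ε • y ∈ C := by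
  -- On the line through `x` and `x - y` the parameter `1 + ε` gives `x + ε • y`.
  have hO : IsOpen {t : ℝ | t • x + (1 - t) • (x - y) ∈ lineInterior C} :=
    @isOpen_interior V (lineTopology V) C x hx (x - y)
  obtain ⟨ε, hε, hball⟩ := Metric.isOpen_iff.1 hO 1 (by simpa using hx)
  refine ⟨ε / 2, half_pos hε, ?_⟩
  have h1 : (1 + ε / 2) • x + (1 - (1 + ε / 2)) • (x - y) ∈ lineInterior C := by
    refine hball ?_
    rw [Metric.mem_ball, Real.dist_eq, add_sub_cancel_left, abs_of_pos (half_pos hε)]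
    exact half_lt_self hε
  convert lineInterior_subset h1 using 1
  module

/-- Translations preserve openness, so the interior translated by `y` is an open subset of `C`. -/
theorem add_mem_lineInterior (hC : ∀ x ∈ C, ∀ y ∈ C, x + y ∈ C) (hx : x ∈ lineInterior C)
    (hy : y ∈ C) : x + y ∈ lineInterior C := by
  refine (@mem_interior V (lineTopology V) (x + y) C).2
    ⟨{z | z - y ∈ lineInterior C}, fun z hz => ?_, fun z hz b => ?_, by simpa using hx⟩
  · simpa using hC _ (lineInterior_subset hz) _ hy
  · have h1 : IsOpen {t : ℝ | t • (z - y) + (1 - t) • (b - y) ∈ lineInterior C} :=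
      @isOpen_interior V (lineTopology V) C _ hz (b - y)
    convert h1 using 3 with t
    change t • z + (1 - t) • b - y ∈ lineInterior C ↔ _
    rw [show t • z + (1 - t) • b - y = t • (z - y) + (1 - t) • (b - y) by module]

theorem mem_lineBoundary_iff_of_mem (hx : x ∈ C) : x ∈ lineBoundary C ↔ x ∉ lineInterior C :=
  ⟨fun h => h.2, fun h => ⟨@subset_closure V (lineTopology V) C x hx, h⟩⟩

end LineTopology

/-! ### The convex hull of an additive submonoid is a cone. -/

section ConvexHull

open scoped Pointwise

variable {V : Type*} [AddCommGroup V] [Module ℝ V] {S : Set V}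

theorem add_mem_convexHull (hS : ∀ x ∈ S, ∀ y ∈ S, x + y ∈ S) {x y : V}
    (hx : x ∈ convexHull ℝ S) (hy : y ∈ convexHull ℝ S) : x + y ∈ convexHull ℝ S := by
  have h1 : x + y ∈ convexHull ℝ (S + S) := by
    rw [convexHull_add]
    exact Set.add_mem_add hx hy
  refine convexHull_mono ?_ h1
  rintro _ ⟨a, ha, b, hb, rfl⟩
  exact hS a ha b hb

/-- Natural multiples come from addition, and `c • x` lies on a segment from `0` to such a multiple.
-/
theorem smul_mem_convexHull (hS : ∀ x ∈ S, ∀ y ∈ S, x + y ∈ S) (h0 : (0 : V) ∈ S) {x : V}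
    (hx : x ∈ convexHull ℝ S) {c : ℝ} (hc : 0 ≤ c) : c • x ∈ convexHull ℝ S := by
  have h0' := subset_convexHull ℝ S h0
  have hn : ∀ n : ℕ, (n : ℝ) • x ∈ convexHull ℝ S := by
    intro n
    induction n with
    | zero => simpa using h0'
    | succ n ih =>
      rw [Nat.cast_succ, add_smul, one_smul]
      exact add_mem_convexHull hS ih hx
  obtain ⟨n, hn'⟩ := exists_nat_gt c
  have hpos : (0 : ℝ) < n := hc.trans_lt hn'
  have h1 := (convex_convexHull ℝ S).smul_mem_of_zero_mem h0' (hn n)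
    (t := c / n) ⟨by positivity, (div_le_one hpos).2 hn'.le⟩
  rwa [smul_smul, div_mul_cancel₀ _ hpos.ne'] at h1

end ConvexHull

/-! ### Boundary condition and number of extensions on `V_a`. -/

section Extensions

variable {V : Type*} [AddCommGroup V] [Module ℝ V] {Q : Set V}

theorem IsLinearConeOn.convex (hQ : IsLinearConeOn ⊤ Q) : Convex ℝ Q :=
  fun _ hx _ hy _ _ hs ht _ => hQ.add_mem _ (hQ.smul_mem _ hs _ hx) _ (hQ.smul_mem _ ht _ hy)

theorem IsLinearConeOn.boundaryCondition (hQ : IsLinearConeOn ⊤ Q) {C : Set V} (hC : C ⊆ Q) {a : V}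
    (ha : a ≠ 0) : BoundaryCondition C Q a := by
  rintro x ⟨hxC, hxH⟩
  refine ⟨⟨hxH, hC hxC⟩, (mem_lineBoundary_iff_of_mem hxC).2 fun hint => ?_⟩
  -- An interior point `x ∈ H_a` would have `x - ε|a| ∈ C ⊆ Q`, although its negative is positive
  -- too; then `|a| ∈ H_a`.
  obtain ⟨ε, hε, hmem⟩ := exists_add_smul_mem_of_mem_lineInterior hint (-coneAbs Q a)
  have h1 := hQ.add_smul_coneAbs_mem (neg_mem hxH) hε
  have h2 := hQ.pure _ h1 (by convert hC hmem using 1; module)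
  have h3 : ε • coneAbs Q a ∈ orderHyperplane Q a := by
    rw [neg_add_eq_zero.1 h2] at hxH
    exact hxH
  exact hQ.coneAbs_notMem_orderHyperplane ha ((Submodule.smul_mem_iff _ hε.ne').1 h3)

theorem IsLinearConeOn.mem_orderSubspace_of_add_mem (hQ : IsLinearConeOn ⊤ Q) {a x y : V}
    (hx : x ∈ Q) (hy : y ∈ Q) (h : x + y ∈ orderSubspace Q a) : x ∈ orderSubspace Q a := by
  obtain ⟨t, ht, -⟩ := hQ.mem_orderSubspace_iff.1 h
  have h1 : t • coneAbs Q a - x ∈ Q := by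
    convert hQ.add_mem _ ht _ hy using 1
    module
  refine hQ.mem_orderSubspace_iff.2 ⟨t, h1, ?_⟩
  convert hQ.add_mem _ h1 _ (hQ.smul_mem 2 zero_le_two _ hx) using 1
  module

/-- `V_a` is order convex: if a sum of positive vectors lies in `V_a`, so do the summands. Therefore
the hypothesis on `S` passes to convex combinations. -/
theorem IsLinearConeOn.convexHull_inter_orderSubspace_subset (hQ : IsLinearConeOn ⊤ Q) {S : Set V}
    (hS : S ⊆ Q) {a : V} (h : ∀ x ∈ S, x ∈ orderSubspace Q a → x ∈ orderHyperplane Q a) :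
    convexHull ℝ S ∩ orderSubspace Q a ⊆ hyperplaneCone Q a := by
  have key : convexHull ℝ S ⊆ {x | x ∈ Q ∧ (x ∈ orderSubspace Q a → x ∈ orderHyperplane Q a)} := by
    refine convexHull_min (fun x hx => ⟨hS hx, h x hx⟩) ?_
    rintro x ⟨hxQ, hx⟩ y ⟨hyQ, hy⟩ s t hs ht hst
    have hsQ := hQ.smul_mem s hs x hxQ
    have htQ := hQ.smul_mem t ht y hyQ
    refine ⟨hQ.add_mem _ hsQ _ htQ, fun hV => ?_⟩
    have scale : ∀ (c : ℝ) (z : V), (z ∈ orderSubspace Q a → z ∈ orderHyperplane Q a) →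
        c • z ∈ orderSubspace Q a → c • z ∈ orderHyperplane Q a := by
      intro c z hz hcz
      rcases eq_or_ne c 0 with rfl | hc
      · simp
      · exact Submodule.smul_mem _ _ (hz ((Submodule.smul_mem_iff _ hc).1 hcz))
    refine AddMemClass.add_mem (scale s x hx (hQ.mem_orderSubspace_of_add_mem hsQ htQ hV))
      (scale t y hy (hQ.mem_orderSubspace_of_add_mem htQ hsQ ?_))
    rwa [add_comm]
  rintro x ⟨hx, hxV⟩
  exact ⟨(key hx).2 hxV, (key hx).1⟩

theorem IsLinearConeOn.extensionsDefinedBy_eq (hQ : IsLinearConeOn ⊤ Q) (C : Set V) {a : V}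
    (ha : a ≠ 0) :
    extensionsDefinedBy C (orderSubspace Q a) (orderHyperplane Q a) (hyperplaneCone Q a) =
      {R | (R = halfSpaceCone (orderHyperplane Q a) (hyperplaneCone Q a) (coneAbs Q a) ∨
        R = halfSpaceCone (orderHyperplane Q a) (hyperplaneCone Q a) (-coneAbs Q a)) ∧
        C ∩ orderSubspace Q a ⊆ R} := by
  ext R
  have hP := hQ.isLinearConeOn_hyperplaneCone a
  have hb := hQ.coneAbs_notMem_orderHyperplane ha
  have hb' : -coneAbs Q a ∉ orderHyperplane Q a := by rwa [neg_mem_iff]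
  have hV := hQ.coneAbs_mem_orderSubspace a
  constructor
  · rintro ⟨-, ⟨b, hbV, hbH, rfl⟩, hCR⟩
    refine ⟨?_, hCR⟩
    obtain ⟨h, hh, s, rfl⟩ := hQ.exists_eq_add_smul_coneAbs ha hbV
    rcases lt_trichotomy s 0 with hs | rfl | hs
    · right
      rw [show h + s • coneAbs Q a = h + (-s) • -coneAbs Q a by module]
      exact halfSpaceCone_add_smul _ hh (neg_pos.2 hs)
    · exact absurd (by simpa using hh) hbH
    · exact Or.inl (halfSpaceCone_add_smul _ hh hs)
  · rintro ⟨rfl | rfl, hCR⟩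
    · refine ⟨?_, ⟨_, hV, hb, rfl⟩, hCR⟩
      rw [← hQ.orderHyperplane_sup_span_coneAbs ha]
      exact isLinearConeOn_halfSpaceCone hP hb
    · refine ⟨?_, ⟨_, neg_mem hV, hb', rfl⟩, hCR⟩
      have := isLinearConeOn_halfSpaceCone hP hb'
      rwa [← Set.neg_singleton, Submodule.span_neg, hQ.orderHyperplane_sup_span_coneAbs ha] at this

theorem IsLinearConeOn.numExtensions_eq_one (hQ : IsLinearConeOn ⊤ Q) {S : Set V} (hS : S ⊆ Q)
    {a : V} (ha : a ≠ 0) (h : (partOffHyperplane S Q a).Nonempty) :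
    numExtensions (convexHull ℝ S) Q a = 1 := by
  have hP := hQ.isLinearConeOn_hyperplaneCone a
  have hb := hQ.coneAbs_notMem_orderHyperplane ha
  have hb' : -coneAbs Q a ∉ orderHyperplane Q a := by rwa [neg_mem_iff]
  rw [numExtensions, hQ.extensionsDefinedBy_eq _ ha, Set.encard_eq_one]
  refine ⟨halfSpaceCone (orderHyperplane Q a) (hyperplaneCone Q a) (coneAbs Q a), ?_⟩
  ext R
  constructor
  · rintro ⟨rfl | rfl, hCR⟩
    · rfl
    · exfalso
      obtain ⟨x, hxV, hxS, hxH⟩ := h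
      have h1 := hCR ⟨subset_convexHull ℝ S hxS, hxV⟩
      have h2 : x ∈ halfSpaceCone (orderHyperplane Q a) (hyperplaneCone Q a) (coneAbs Q a) := by
        rw [← hQ.orderSubspace_inter_eq_halfSpaceCone ha]
        exact ⟨hxV, hS hxS⟩
      obtain ⟨k, hk, s, rfl⟩ := hQ.exists_eq_add_smul_coneAbs ha hxV
      rw [add_smul_mem_halfSpaceCone_iff hP hb hk] at h2
      rw [show k + s • coneAbs Q a = k + (-s) • -coneAbs Q a by module,
        add_smul_mem_halfSpaceCone_iff hP hb' hk] at h1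
      have hs : s = 0 := by
        rcases h1 with h1 | h1 <;> rcases h2 with h2 | h2 <;> linarith
      subst hs
      exact hxH (by simpa using hk)
  · rintro rfl
    refine ⟨Or.inl rfl, ?_⟩
    rw [← hQ.orderSubspace_inter_eq_halfSpaceCone ha]
    exact fun x hx => ⟨hx.2, convexHull_min hS hQ.convex hx.1⟩

theorem IsLinearConeOn.numExtensions_eq_two (hQ : IsLinearConeOn ⊤ Q) {S : Set V} (hS : S ⊆ Q)
    {a : V} (ha : a ≠ 0) (h : ¬ (partOffHyperplane S Q a).Nonempty) :
    numExtensions (convexHull ℝ S) Q a = 2 := by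
  have hP := hQ.isLinearConeOn_hyperplaneCone a
  have hb := hQ.coneAbs_notMem_orderHyperplane ha
  have hb' : -coneAbs Q a ∉ orderHyperplane Q a := by rwa [neg_mem_iff]
  rw [numExtensions, hQ.extensionsDefinedBy_eq _ ha, Set.encard_eq_two]
  refine ⟨_, _, ?_, Set.ext fun R => ⟨fun hR => hR.1, fun hR => ⟨hR, ?_⟩⟩⟩
  · intro heq
    have h1 : coneAbs Q a ∈
        halfSpaceCone (orderHyperplane Q a) (hyperplaneCone Q a) (coneAbs Q a) :=
      Or.inr ⟨0, Submodule.zero_mem _, 1, one_pos, by simp⟩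
    rw [heq] at h1
    have h2 := (add_smul_mem_halfSpaceCone_iff hP hb' (Submodule.zero_mem _) (t := -1)).1 (by
      convert h1 using 1
      module)
    rcases h2 with h2 | h2 <;> linarith
  · have hsub := hQ.convexHull_inter_orderSubspace_subset hS (a := a) fun x hx hxV => by
      by_contra hxH
      exact h ⟨x, hxV, hx, hxH⟩
    rcases hR with rfl | rfl <;> exact hsub.trans Set.subset_union_left

end Extensions

/-! ### Changing the order above a hyperplane. -/

section Flip

variable {V : Type*} [AddCommGroup V] [Module ℝ V] {H : Submodule ℝ V} {P : Set V} {b : V}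

theorem coneAbs_halfSpaceCone_of_mem (hP : IsLinearConeOn H P) (hb : b ∉ H) {c : V} (hc : c ∈ H) :
    coneAbs (halfSpaceCone H P b) c = coneAbs P c := by
  by_cases h : c ∈ P <;> simp [coneAbs, mem_halfSpaceCone_iff_of_mem hP hb hc, h]

theorem coneAbs_mem_submodule {c : V} (hc : c ∈ H) (P : Set V) : coneAbs P c ∈ H := by
  unfold coneAbs
  split_ifs
  · exact hc
  · exact neg_mem hc

theorem mem_orderSubspace_halfSpaceCone_of_mem (hP : IsLinearConeOn H P) (hb : b ∉ H)
    (htop : H ⊔ Submodule.span ℝ {b} = ⊤) {c : V} (hc : c ∈ H) {x : V} :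
    x ∈ orderSubspace (halfSpaceCone H P b) c ↔
      x ∈ H ∧ ∃ t : ℝ, t • coneAbs P c - x ∈ P ∧ t • coneAbs P c + x ∈ P := by
  have hQ := isLinearConeOn_halfSpaceCone hP hb
  rw [htop] at hQ
  have hc' := coneAbs_mem_submodule hc P
  rw [hQ.mem_orderSubspace_iff, coneAbs_halfSpaceCone_of_mem hP hb hc]
  constructor
  · rintro ⟨t, h1, h2⟩
    obtain ⟨h, hh, s, rfl⟩ := mem_sup_span_singleton_iff.1 (htop ▸ Submodule.mem_top : x ∈ _)
    rw [show t • coneAbs P c - (h + s • b) = (t • coneAbs P c - h) + (-s) • b by module,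
      add_smul_mem_halfSpaceCone_iff hP hb (sub_mem (Submodule.smul_mem _ _ hc') hh)] at h1
    rw [← add_assoc, add_smul_mem_halfSpaceCone_iff hP hb
      (add_mem (Submodule.smul_mem _ _ hc') hh)] at h2
    have hs : s = 0 := by
      rcases h1 with h1 | h1 <;> rcases h2 with h2 | h2 <;> linarith
    subst hs
    simp only [neg_zero, lt_self_iff_false, true_and, false_or] at h1 h2
    simp only [zero_smul, add_zero]
    exact ⟨hh, t, h1, h2⟩
  · rintro ⟨hx, t, h1, h2⟩
    exact ⟨t, Or.inl h1, Or.inl h2⟩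

theorem mem_orderHyperplane_halfSpaceCone_of_mem (hP : IsLinearConeOn H P) (hb : b ∉ H)
    (htop : H ⊔ Submodule.span ℝ {b} = ⊤) {c : V} (hc : c ∈ H) {x : V} :
    x ∈ orderHyperplane (halfSpaceCone H P b) c ↔
      x ∈ H ∧ ∀ t : ℝ, coneAbs P c - t • x ∈ P := by
  have hQ := isLinearConeOn_halfSpaceCone hP hb
  rw [htop] at hQ
  have hc' := coneAbs_mem_submodule hc P
  rw [hQ.mem_orderHyperplane_iff, coneAbs_halfSpaceCone_of_mem hP hb hc]
  constructor
  · intro hx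
    obtain ⟨h, hh, s, rfl⟩ := mem_sup_span_singleton_iff.1 (htop ▸ Submodule.mem_top : x ∈ _)
    -- Testing with the multiple `s` makes the coefficient of `b` equal to `-(s * s)`, which is
    -- nonnegative only for `s = 0`.
    have h1 := hx s
    rw [show coneAbs P c - s • (h + s • b) = (coneAbs P c - s • h) + (-(s * s)) • b by module,
      add_smul_mem_halfSpaceCone_iff hP hb (sub_mem hc' (Submodule.smul_mem _ _ hh))] at h1
    have hs : s = 0 := by
      rcases h1 with h1 | h1
      · nlinarith [mul_self_nonneg s]
      · simpa using h1.1
    subst hs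
    simp only [zero_smul, add_zero] at hx ⊢
    refine ⟨hh, fun t => ?_⟩
    rw [← mem_halfSpaceCone_iff_of_mem hP hb (sub_mem hc' (Submodule.smul_mem _ _ hh))]
    exact hx t
  · rintro ⟨hx, h⟩ t
    exact Or.inl (h t)

theorem exists_coneAbs_halfSpaceCone_eq (hP : IsLinearConeOn H P) (hb : b ∉ H)
    (htop : H ⊔ Submodule.span ℝ {b} = ⊤) {c : V} (hc : c ∉ H) :
    ∃ h ∈ H, ∃ t : ℝ, 0 < t ∧ coneAbs (halfSpaceCone H P b) c = h + t • b := by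
  have hQ := isLinearConeOn_halfSpaceCone hP hb
  rw [htop] at hQ
  rcases hQ.coneAbs_mem c with h | h
  · refine absurd (hP.subset h) ?_
    unfold coneAbs
    split_ifs
    · exact hc
    · simpa using hc
  · exact h

theorem orderSubspace_halfSpaceCone_of_notMem (hP : IsLinearConeOn H P) (hb : b ∉ H)
    (htop : H ⊔ Submodule.span ℝ {b} = ⊤) {c : V} (hc : c ∉ H) :
    orderSubspace (halfSpaceCone H P b) c = ⊤ := by
  have hQ := isLinearConeOn_halfSpaceCone hP hb
  rw [htop] at hQ
  obtain ⟨h, hh, t, ht, heq⟩ := exists_coneAbs_halfSpaceCone_eq hP hb htop hc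
  refine eq_top_iff.2 fun x _ => hQ.mem_orderSubspace_iff.2 ?_
  obtain ⟨k, hk, s, rfl⟩ := mem_sup_span_singleton_iff.1 (htop ▸ Submodule.mem_top : x ∈ _)
  -- This multiple of `|c|` has `b`-coefficient `|s| + 1`, dominating `±s` regardless of the
  -- `H`-components.
  have h1 : |s| < (|s| + 1) / t * t := by
    rw [div_mul_cancel₀ _ ht.ne']
    linarith
  refine ⟨(|s| + 1) / t, ?_, ?_⟩ <;> rw [heq]
  · exact Or.inr ⟨_, sub_mem (Submodule.smul_mem _ ((|s| + 1) / t) hh) hk, (|s| + 1) / t * t - s,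
      by linarith [le_abs_self s], by module⟩
  · exact Or.inr ⟨_, add_mem (Submodule.smul_mem _ ((|s| + 1) / t) hh) hk, (|s| + 1) / t * t + s,
      by linarith [neg_abs_le s], by module⟩

theorem orderHyperplane_halfSpaceCone_of_notMem (hP : IsLinearConeOn H P) (hb : b ∉ H)
    (htop : H ⊔ Submodule.span ℝ {b} = ⊤) {c : V} (hc : c ∉ H) :
    orderHyperplane (halfSpaceCone H P b) c = H := by
  have hQ := isLinearConeOn_halfSpaceCone hP hb
  rw [htop] at hQ
  obtain ⟨h, hh, t, ht, heq⟩ := exists_coneAbs_halfSpaceCone_eq hP hb htop hc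
  ext x
  rw [hQ.mem_orderHyperplane_iff, heq]
  constructor
  · intro hx
    obtain ⟨k, hk, s, rfl⟩ := mem_sup_span_singleton_iff.1 (htop ▸ Submodule.mem_top : x ∈ _)
    by_cases hs : s = 0
    · simpa [hs] using hk
    -- The multiple is chosen so that the coefficient of `b` becomes `t - (t + 1) = -1`.
    · have h1 := hx ((t + 1) / s)
      rw [show h + t • b - ((t + 1) / s) • (k + s • b) =
          (h - ((t + 1) / s) • k) + (-1 : ℝ) • b by
            match_scalars <;> field_simp
            ring,
        add_smul_mem_halfSpaceCone_iff hP hb (sub_mem hh (Submodule.smul_mem _ _ hk))] at h1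
      rcases h1 with h1 | h1 <;> linarith
  · intro hx r
    exact Or.inr ⟨h - r • x, sub_mem hh (Submodule.smul_mem _ _ hx), t, ht, by module⟩

/-- The subspaces and ordered hyperplanes given by an order depend only on its restriction to a
convex hyperplane. -/
theorem halfSpaceCone_congr {b' : V} (hP : IsLinearConeOn H P) (hb : b ∉ H)
    (htop : H ⊔ Submodule.span ℝ {b} = ⊤) (hb' : b' ∉ H)
    (htop' : H ⊔ Submodule.span ℝ {b'} = ⊤) (c : V) :
    orderSubspace (halfSpaceCone H P b') c = orderSubspace (halfSpaceCone H P b) c ∧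
    orderHyperplane (halfSpaceCone H P b') c = orderHyperplane (halfSpaceCone H P b) c ∧
    hyperplaneCone (halfSpaceCone H P b') c = hyperplaneCone (halfSpaceCone H P b) c := by
  have key : ∀ {W W' : Submodule ℝ V}, W' = W → W ≤ H →
      {x | x ∈ W' ∧ x ∈ halfSpaceCone H P b'} = {x | x ∈ W ∧ x ∈ halfSpaceCone H P b} := by
    rintro W _ rfl hW
    ext x
    refine and_congr_right fun hx => ?_
    rw [mem_halfSpaceCone_iff_of_mem hP hb (hW hx), mem_halfSpaceCone_iff_of_mem hP hb' (hW hx)]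
  by_cases hc : c ∈ H
  · have h1 : orderHyperplane (halfSpaceCone H P b') c = orderHyperplane (halfSpaceCone H P b) c := by
      ext x
      rw [mem_orderHyperplane_halfSpaceCone_of_mem hP hb htop hc,
        mem_orderHyperplane_halfSpaceCone_of_mem hP hb' htop' hc]
    refine ⟨?_, h1, key h1 fun x hx => ?_⟩
    · ext x
      rw [mem_orderSubspace_halfSpaceCone_of_mem hP hb htop hc,
        mem_orderSubspace_halfSpaceCone_of_mem hP hb' htop' hc]
    · exact ((mem_orderHyperplane_halfSpaceCone_of_mem hP hb htop hc).1 hx).1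
  · have h0 := orderHyperplane_halfSpaceCone_of_notMem hP hb htop hc
    have h1 : orderHyperplane (halfSpaceCone H P b') c = orderHyperplane (halfSpaceCone H P b) c := by
      rw [h0, orderHyperplane_halfSpaceCone_of_notMem hP hb' htop' hc]
    refine ⟨?_, h1, key h1 h0.le⟩
    rw [orderSubspace_halfSpaceCone_of_notMem hP hb htop hc,
      orderSubspace_halfSpaceCone_of_notMem hP hb' htop' hc]

end Flip

/-! ### Extending salient cones to linear orders. -/

section Zorn

variable {V : Type*} [AddCommGroup V] [Module ℝ V]

/-- A maximal salient cone is total: if `-x` is missing from it, adjoining the ray through `x` keeps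
it salient. -/
theorem exists_isLinearConeOn_top_of_salient (K : PointedCone ℝ V)
    (hK : ∀ x ∈ K, -x ∈ K → x = 0) : ∃ Q : Set V, IsLinearConeOn ⊤ Q ∧ (K : Set V) ⊆ Q := by
  obtain ⟨M, hKM, hM⟩ := zorn_le_nonempty₀ {L : PointedCone ℝ V | ∀ x ∈ L, -x ∈ L → x = 0}
    (fun c hc hchain y hy => by
      have hmem : ∀ {z}, z ∈ sSup c ↔ ∃ L ∈ c, z ∈ L :=
        Submodule.mem_sSup_of_directed ⟨y, hy⟩ hchain.directedOn
      refine ⟨sSup c, fun x hx hx' => ?_, fun L hL => le_sSup hL⟩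
      obtain ⟨L, hL, hxL⟩ := hmem.1 hx
      obtain ⟨L', hL', hxL'⟩ := hmem.1 hx'
      rcases hchain.total hL hL' with h | h
      · exact hc hL' x (h hxL) hxL'
      · exact hc hL x hxL (h hxL')) K hK
  have hsmul : ∀ (t : ℝ), 0 ≤ t → ∀ x ∈ M, t • x ∈ M := fun t ht x hx => M.smul_mem ht hx
  have key : ∀ x, -x ∉ M → x ∈ M := by
    intro x hx
    let N : PointedCone ℝ V :=
      { carrier := {z | ∃ p ∈ M, ∃ t : ℝ, 0 ≤ t ∧ z = p + t • x}
        add_mem' := by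
          rintro _ _ ⟨p, hp, s, hs, rfl⟩ ⟨q, hq, t, ht, rfl⟩
          exact ⟨p + q, add_mem hp hq, s + t, add_nonneg hs ht, by module⟩
        zero_mem' := ⟨0, zero_mem _, 0, le_rfl, by simp⟩
        smul_mem' := by
          rintro ⟨c, hc⟩ _ ⟨p, hp, s, hs, rfl⟩
          refine ⟨c • p, hsmul c hc p hp, c * s, mul_nonneg hc hs, ?_⟩
          change c • (p + s • x) = _
          module }
    have hMN : M ≤ N := fun p hp => ⟨p, hp, 0, le_rfl, by simp⟩
    have hN : ∀ z ∈ N, -z ∈ N → z = 0 := by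
      rintro _ ⟨p, hp, s, hs, rfl⟩ ⟨q, hq, t, ht, heq⟩
      -- If `s + t > 0`, dividing would put `-x` into `M`; otherwise both vectors already lie in
      -- `M`.
      have h1 : p + q = (s + t) • -x := by
        have : p + q + (s + t) • x = 0 := by
          rw [show p + q + (s + t) • x = (q + t • x) + (p + s • x) by module, ← heq,
            neg_add_cancel]
        rw [smul_neg]
        exact eq_neg_of_add_eq_zero_left this
      rcases (add_nonneg hs ht).eq_or_lt with h0 | h0
      · have hs0 : s = 0 := by linarith
        have ht0 : t = 0 := by linarith
        subst hs0 ht0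
        simp only [zero_smul, add_zero] at heq ⊢
        exact hM.prop p hp (heq ▸ hq)
      · refine absurd ?_ hx
        have h2 := hsmul (s + t)⁻¹ (inv_nonneg.2 h0.le) _ (add_mem hp hq)
        rwa [h1, inv_smul_smul₀ h0.ne'] at h2
    exact hM.le_of_ge hN hMN ⟨0, zero_mem _, 1, zero_le_one, by simp⟩
  refine ⟨M, ⟨fun _ _ => trivial, fun x hx y hy => add_mem hx hy, hsmul, hM.prop, fun x _ => ?_⟩,
    hKM⟩
  by_contra! h
  exact h.1 (key x h.2)

end Zorn

/-! ### From real to integer relations between rational vectors. -/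

section RationalFunctionals

open Filter Topology

/-- The elements of a `ℚ`-basis of `ℝ` are replaced by rational approximations; each real is a
finite rational combination of them, so convergence is pointwise. -/
theorem exists_seq_ratLinear_tendsto :
    ∃ f : ℕ → ℝ →ₗ[ℚ] ℚ, ∀ t : ℝ, Tendsto (fun n => (f n t : ℝ)) atTop (𝓝 t) := by
  have happrox : ∀ (r : ℝ) (n : ℕ), ∃ q : ℚ, |r - q| < 1 / ((n : ℝ) + 1) := fun r n =>
    exists_rat_near r Nat.one_div_pos_of_nat
  choose y hy using happrox
  have hlim : ∀ r : ℝ, Tendsto (fun n => (y r n : ℝ)) atTop (𝓝 r) := by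
    intro r
    rw [tendsto_iff_dist_tendsto_zero]
    refine squeeze_zero (fun _ => dist_nonneg) (fun n => ?_)
      (tendsto_one_div_add_atTop_nhds_zero_nat (𝕜 := ℝ))
    rw [dist_comm, Real.dist_eq]
    exact (hy r n).le
  let B := Module.Basis.ofVectorSpace ℚ ℝ
  refine ⟨fun n => B.constr ℚ fun i => y (B i) n, fun t => ?_⟩
  have h1 : ∀ n, ((B.constr ℚ (fun i => y (B i) n) t : ℚ) : ℝ) =
      ∑ i ∈ (B.repr t).support, ((B.repr t i : ℚ) : ℝ) * (y (B i) n : ℝ) := by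
    intro n
    rw [Module.Basis.constr_apply, Finsupp.sum]
    push_cast [smul_eq_mul]
    rfl
  have h2 : t = ∑ i ∈ (B.repr t).support, ((B.repr t i : ℚ) : ℝ) * B i := by
    conv_lhs => rw [← B.linearCombination_repr t, Finsupp.linearCombination_apply, Finsupp.sum]
    simp only [Rat.smul_def]
  simp only [h1]
  conv => enter [3, 1]; rw [h2]
  exact tendsto_finsetSum _ fun i _ => (hlim _).const_mul _

theorem exists_ratLinear_pos {ι : Type*} (s : Finset ι) (t : ι → ℝ) (ht : ∀ i ∈ s, 0 < t i) :
    ∃ f : ℝ →ₗ[ℚ] ℚ, ∀ i ∈ s, 0 < f (t i) := by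
  obtain ⟨f, hf⟩ := exists_seq_ratLinear_tendsto
  have h : ∀ᶠ n in atTop, ∀ i ∈ s, (0 : ℝ) < f n (t i) :=
    (Filter.eventually_all_finset s).2 fun i hi => (hf (t i)).eventually_const_lt (ht i hi)
  obtain ⟨n, hn⟩ := h.exists
  exact ⟨f n, fun i hi => by exact_mod_cast hn i hi⟩

/-- A real relation with positive coefficients between rational vectors yields one with positive
integer coefficients. -/
theorem exists_nat_relation {ι κ : Type*} (s : Finset ι) (t : ι → ℝ) (ht : ∀ i ∈ s, 0 < t i)
    (v : ι → κ →₀ ℚ) (h : ∑ i ∈ s, t i • ratToReal (v i) = 0) :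
    ∃ n : ι → ℕ, (∀ i ∈ s, 0 < n i) ∧ ∑ i ∈ s, n i • v i = 0 := by
  obtain ⟨f, hf⟩ := exists_ratLinear_pos s t ht
  -- In each coordinate the relation is `ℚ`-linear in the `t i`, so `f` may be applied to it.
  have hfv : ∑ i ∈ s, f (t i) • v i = 0 := by
    ext k
    have h1 : ∑ i ∈ s, (v i k) • t i = 0 := by
      have := DFunLike.congr_fun h k
      simpa [ratToReal, Finsupp.finsetSum_apply, Rat.smul_def, mul_comm] using this
    have h2 := congrArg f h1
    simpa [Finsupp.finsetSum_apply, mul_comm] using h2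
  obtain ⟨⟨b, hb⟩, hint⟩ :=
    IsLocalization.exist_integer_multiples (nonZeroDivisors ℤ) s fun i => f (t i)
  have hb0 : b ≠ 0 := nonZeroDivisors.ne_zero hb
  have hn : ∀ i, ∃ n : ℕ, i ∈ s → 0 < n ∧ (n : ℚ) = |(b : ℚ)| * f (t i) := by
    intro i
    by_cases hi : i ∈ s
    · obtain ⟨z, hz⟩ := hint i hi
      have hz' : (z : ℚ) = b * f (t i) := by simpa using hz
      have hpos : 0 < |(b : ℚ)| * f (t i) :=
        mul_pos (abs_pos.2 (by exact_mod_cast hb0)) (hf i hi)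
      have heq : ((z.natAbs : ℕ) : ℚ) = |(b : ℚ)| * f (t i) := by
        rw [Nat.cast_natAbs, Int.cast_abs, hz', abs_mul, abs_of_pos (hf i hi)]
      refine ⟨z.natAbs, fun _ => ⟨?_, heq⟩⟩
      rw [← heq] at hpos
      exact_mod_cast hpos
    · exact ⟨0, fun h => absurd h hi⟩
  choose n hn using hn
  refine ⟨n, fun i hi => (hn i hi).1, ?_⟩
  calc ∑ i ∈ s, n i • v i = ∑ i ∈ s, |(b : ℚ)| • f (t i) • v i := by
        refine Finset.sum_congr rfl fun i hi => ?_
        rw [smul_smul, ← (hn i hi).2, Nat.cast_smul_eq_nsmul]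
    _ = 0 := by rw [← Finset.smul_sum, hfv, smul_zero]

end RationalFunctionals

/-! ### The map `φ` as an injective group homomorphism. -/

section Embedding

variable {G : Type*} [AddCommGroup G] {E : Set G} (hE : IsMaximalIndependent E)
include hE

/-- By independence of `E`, two representations of `g` are proportional, so the chosen one can be
traded for any other. -/
theorem smul_ratEmbedding_eq {g : G} {q : ℕ} {p : E →₀ ℤ}
    (h : q • g = p.sum fun a n => n • (a : G)) :
    (q : ℚ) • ratEmbedding hE g = p.mapRange Int.cast Int.cast_zero := by
  obtain ⟨hq', h'⟩ := Classical.choose_spec (exists_integral_representation hE g)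
  rw [ratEmbedding]
  set q' := (Classical.choose (exists_integral_representation hE g)).1
  set p' := (Classical.choose (exists_integral_representation hE g)).2
  have hli : LinearIndependent ℤ (fun a : E => (a : G)) := hE.1
  have heq : (q : ℤ) • p' = (q' : ℤ) • p := by
    apply hli
    rw [map_smul, map_smul, Finsupp.linearCombination_apply, Finsupp.linearCombination_apply,
      ← h, ← h', natCast_zsmul, natCast_zsmul, smul_smul, smul_smul, mul_comm]
  have hq0 : (q' : ℚ) ≠ 0 := by exact_mod_cast hq'.ne'
  rw [smul_comm, inv_smul_eq_iff₀ hq0]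
  ext a
  have := DFunLike.congr_fun heq a
  simp only [Finsupp.smul_apply, smul_eq_mul] at this
  simp only [Finsupp.smul_apply, smul_eq_mul, Finsupp.mapRange_apply]
  exact_mod_cast this

theorem ratEmbedding_add (g h : G) :
    ratEmbedding hE (g + h) = ratEmbedding hE g + ratEmbedding hE h := by
  obtain ⟨⟨q, p⟩, hq, hp⟩ := exists_integral_representation hE g
  obtain ⟨⟨q', p'⟩, hq', hp'⟩ := exists_integral_representation hE h
  simp only at hq hp hq' hp'
  have h1 : (q * q') • (g + h) =
      ((q' : ℤ) • p + (q : ℤ) • p').sum fun a n => n • (a : G) := by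
    have hl : ∀ x : E →₀ ℤ, Finsupp.linearCombination ℤ (fun a : E => (a : G)) x =
        x.sum fun a n => n • (a : G) := fun x => Finsupp.linearCombination_apply ℤ x
    rw [← hl] at hp hp' ⊢
    rw [map_add, map_smul, map_smul, ← hp, ← hp', natCast_zsmul, natCast_zsmul, smul_smul,
      smul_smul, smul_add, mul_comm q' q]
  have e := smul_ratEmbedding_eq hE h1
  have e1 := smul_ratEmbedding_eq hE hp
  have e2 := smul_ratEmbedding_eq hE hp'
  have hne : ((q * q' : ℕ) : ℚ) ≠ 0 := by positivity
  apply smul_right_injective _ hne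
  change ((q * q' : ℕ) : ℚ) • _ = ((q * q' : ℕ) : ℚ) • _
  have e3 : (((q' : ℤ) • p + (q : ℤ) • p').mapRange Int.cast Int.cast_zero : E →₀ ℚ) =
      (q' : ℚ) • p.mapRange Int.cast Int.cast_zero +
        (q : ℚ) • p'.mapRange Int.cast Int.cast_zero := by
    ext a
    simp
  rw [e, e3, ← e1, ← e2, smul_smul, smul_smul, smul_add, Nat.cast_mul, mul_comm (q' : ℚ)]

theorem ratEmbedding_eq_zero [IsAddTorsionFree G] {g : G} (h : ratEmbedding hE g = 0) : g = 0 := by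
  obtain ⟨⟨q, p⟩, hq, hp⟩ := exists_integral_representation hE g
  simp only at hq hp
  have e := smul_ratEmbedding_eq hE hp
  rw [h, smul_zero] at e
  have hp0 : p = 0 := by
    ext a
    have := DFunLike.congr_fun e a
    simpa using this.symm
  rw [hp0, Finsupp.sum_zero_index] at hp
  exact (nsmul_eq_zero_iff_right hq.ne').1 hp

end Embedding

theorem ratToReal_add {ι : Type*} (x y : ι →₀ ℚ) :
    ratToReal (x + y) = ratToReal x + ratToReal y :=
  Finsupp.mapRange_add Rat.cast_add x y

theorem ratToReal_eq_zero {ι : Type*} {x : ι →₀ ℚ} : ratToReal x = 0 ↔ x = 0 := by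
  simp [ratToReal, Finsupp.ext_iff]

/-- `ratEmbedding` as a homomorphism of groups. -/
noncomputable def ratEmbeddingHom {G : Type*} [AddCommGroup G] {E : Set G} (hE : IsMaximalIndependent E) :
    G →+ (E →₀ ℚ) :=
  AddMonoidHom.mk' (ratEmbedding hE) (ratEmbedding_add hE)

/-- `realEmbedding` as a homomorphism of groups. -/
noncomputable def realEmbeddingHom {G : Type*} [AddCommGroup G] {E : Set G} (hE : IsMaximalIndependent E) :
    G →+ (E →₀ ℝ) :=
  AddMonoidHom.mk' (realEmbedding hE) fun g h => by
    rw [realEmbedding, ratEmbedding_add, ratToReal_add]; rfl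

section RealEmbedding

variable {G : Type*} [AddCommGroup G] {E : Set G} (hE : IsMaximalIndependent E)
include hE

theorem realEmbedding_sub (g h : G) :
    realEmbedding hE (g - h) = realEmbedding hE g - realEmbedding hE h :=
  map_sub (realEmbeddingHom hE) g h

theorem realEmbedding_zero : realEmbedding hE 0 = 0 := map_zero (realEmbeddingHom hE)

theorem realEmbedding_eq_zero [IsAddTorsionFree G] {g : G} :
    realEmbedding hE g = 0 ↔ g = 0 :=
  ⟨fun h => ratEmbedding_eq_zero hE (ratToReal_eq_zero.1 h),
    fun h => by rw [h, realEmbedding_zero]⟩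

end RealEmbedding

/-! ### From the boundary condition to an extension. -/

section Converse

variable {V : Type*} [AddCommGroup V] [Module ℝ V] {Q : Set V}

/-- Since `y ∉ V_a`, `|y|` exceeds all multiples of `|a|`, while some multiple of `|b|` exceeds
`|y|`; so all of `V_a` is infinitesimal relative to `|b|`. -/
theorem IsLinearConeOn.orderSubspace_le_orderHyperplane (hQ : IsLinearConeOn ⊤ Q) {a b y : V}
    (hya : y ∉ orderSubspace Q a) (hyb : y ∈ orderSubspace Q b) :
    orderSubspace Q a ≤ orderHyperplane Q b := by
  have hyQ := hQ.coneAbs_mem y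
  have hlarge : ∀ s : ℝ, coneAbs Q y - s • coneAbs Q a ∈ Q := by
    intro s
    by_contra h
    have h1 := (hQ.total _ trivial).resolve_left h
    have h2 : coneAbs Q y ∈ orderSubspace Q a := by
      refine hQ.mem_orderSubspace_iff.2 ⟨s, by convert h1 using 1; module, ?_⟩
      convert hQ.add_mem _ h1 _ (hQ.smul_mem 2 zero_le_two _ hyQ) using 1
      module
    refine hya ?_
    unfold coneAbs at h2
    split_ifs at h2
    · exact h2
    · exact neg_mem_iff.1 h2
  obtain ⟨u, hu, -⟩ := hQ.mem_orderSubspace_iff.1 (coneAbs_mem_submodule hyb Q)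
  have hpos : 0 < max u 1 := lt_max_of_lt_right one_pos
  have hu' : max u 1 • coneAbs Q b - coneAbs Q y ∈ Q := by
    convert hQ.add_mem _ hu _ (hQ.smul_mem (max u 1 - u) (sub_nonneg.2 (le_max_left _ _)) _
      (hQ.coneAbs_mem b)) using 1
    module
  intro z hz
  obtain ⟨t, ht, ht'⟩ := hQ.mem_orderSubspace_iff.1 hz
  refine hQ.mem_orderHyperplane_iff.2 fun r => ?_
  have h1 : (|r| * t) • coneAbs Q a - r • z ∈ Q := by
    rcases le_total 0 r with hr | hr
    · convert hQ.smul_mem r hr _ ht using 1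
      rw [abs_of_nonneg hr]
      module
    · convert hQ.smul_mem (-r) (neg_nonneg.2 hr) _ ht' using 1
      rw [abs_of_nonpos hr]
      module
  have h2 := hQ.add_mem _ (hQ.smul_mem _ (inv_nonneg.2 hpos.le) _
    (hQ.add_mem _ hu' _ (hlarge (max u 1 * (|r| * t))))) _ h1
  convert h2 using 1
  match_scalars <;> field_simp <;> simp

theorem exists_isLinearConeOn_of_boundaryCondition (hQ : IsLinearConeOn ⊤ Q) {A S : Set V}
    (hA : ∀ a ∈ A, a ≠ 0) (hcover : ∀ x : V, x ≠ 0 → ∃ a ∈ A, x ∈ orderSubspace Q a)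
    (hS : ∀ x ∈ S, ∀ y ∈ S, x + y ∈ S) (h0 : (0 : V) ∈ S)
    (hB : ∀ a ∈ A, BoundaryCondition (convexHull ℝ S) Q a)
    (hside : (lineInterior (convexHull ℝ S)).Nonempty ∨ ∀ a ∈ A,
      (∀ x ∈ partOffHyperplane S Q a, x ∈ Q) ∨ ∀ x ∈ partOffHyperplane S Q a, -x ∈ Q) :
    ∃ Q' : Set V, IsLinearConeOn ⊤ Q' ∧ S ⊆ Q' ∧ ∀ a,
      orderSubspace Q' a = orderSubspace Q a ∧ orderHyperplane Q' a = orderHyperplane Q a ∧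
      hyperplaneCone Q' a = hyperplaneCone Q a := by
  have hSC : S ⊆ convexHull ℝ S := subset_convexHull ℝ S
  by_cases htop : ∃ a ∈ A, orderSubspace Q a = ⊤
  · obtain ⟨a, ha, hVa⟩ := htop
    have ha0 := hA a ha
    have hP := hQ.isLinearConeOn_hyperplaneCone a
    have hb := hQ.coneAbs_notMem_orderHyperplane ha0
    have hb' : -coneAbs Q a ∉ orderHyperplane Q a := by rwa [neg_mem_iff]
    have hsup := (hQ.orderHyperplane_sup_span_coneAbs ha0).trans hVa
    have hsup' : orderHyperplane Q a ⊔ Submodule.span ℝ {-coneAbs Q a} = ⊤ := by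
      rw [← Set.neg_singleton, Submodule.span_neg, hsup]
    have hQeq : Q = halfSpaceCone (orderHyperplane Q a) (hyperplaneCone Q a) (coneAbs Q a) := by
      rw [← hQ.orderSubspace_inter_eq_halfSpaceCone ha0, hVa]
      simp
    have hmemQ : ∀ {h : V}, h ∈ orderHyperplane Q a → ∀ {t : ℝ}, h + t • coneAbs Q a ∈ Q ↔
        0 < t ∨ t = 0 ∧ h ∈ hyperplaneCone Q a := by
      intro h hh t
      rw [← add_smul_mem_halfSpaceCone_iff hP hb hh, ← hQeq]
    have hdec : ∀ x : V, ∃ h ∈ orderHyperplane Q a, ∃ s : ℝ, x = h + s • coneAbs Q a :=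
      fun x => hQ.exists_eq_add_smul_coneAbs ha0 (hVa ▸ Submodule.mem_top)
    have hSH : ∀ x ∈ S, x ∈ orderHyperplane Q a → x ∈ hyperplaneCone Q a :=
      fun x hx hxH => (hB a ha ⟨hSC hx, hxH⟩).1
    have hone : (∀ x ∈ S, x ∉ orderHyperplane Q a → x ∈ Q) ∨
        ∀ x ∈ S, x ∉ orderHyperplane Q a → -x ∈ Q := by
      rcases hside with ⟨c, hc⟩ | hside
      · by_contra! hcon
        obtain ⟨⟨x, hxS, hxH, hxQ⟩, y, hyS, hyH, hyQ⟩ := hcon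
        obtain ⟨h, hh, s, rfl⟩ := hdec x
        obtain ⟨k, hk, t, rfl⟩ := hdec y
        obtain ⟨m, hm, u, rfl⟩ := hdec c
        have hs : s < 0 := by
          rcases lt_trichotomy s 0 with hs | rfl | hs
          · exact hs
          · exact absurd (by simpa using hh) hxH
          · exact absurd ((hmemQ hh).2 (Or.inl hs)) hxQ
        have ht : 0 < t := by
          rcases lt_trichotomy t 0 with ht | rfl | ht
          · refine absurd ((hmemQ (neg_mem hk)).2 (Or.inl (neg_pos.2 ht))) ?_
            rwa [show -k + (-t) • coneAbs Q a = -(k + t • coneAbs Q a) by module]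
          · exact absurd (by simpa using hk) hyH
          · exact ht
        have hnot : ∀ z ∈ lineInterior (convexHull ℝ S), z ∉ orderHyperplane Q a :=
          fun z hz hzH => (hB a ha ⟨lineInterior_subset hz, hzH⟩).2.2 hz
        have hadd : ∀ z ∈ S, ∀ r : ℝ, 0 ≤ r →
            m + u • coneAbs Q a + r • z ∈ lineInterior (convexHull ℝ S) := fun z hz r hr =>
          add_mem_lineInterior (fun _ hx _ hy => add_mem_convexHull hS hx hy) hc
            (smul_mem_convexHull hS h0 (hSC hz) hr)
        -- The interior point has `|a|`-coefficient `u`. A nonnegative multiple of `x` or `y`,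
        -- whichever lies on the opposite side, cancels it and keeps the point interior, which
        -- yields a forbidden interior point in `H_a`.
        rcases le_total 0 u with hu | hu
        · refine hnot _ (hadd _ hxS (u / -s) (div_nonneg hu (neg_pos.2 hs).le)) ?_
          have hs' : s ≠ 0 := hs.ne
          have : m + u • coneAbs Q a + (u / -s) • (h + s • coneAbs Q a) = m + (u / -s) • h := by
            match_scalars <;> field_simp
            ring
          rw [this]
          exact add_mem hm (Submodule.smul_mem _ _ hh)
        · refine hnot _ (hadd _ hyS (-u / t) (div_nonneg (neg_nonneg.2 hu) ht.le)) ?_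
          have : m + u • coneAbs Q a + (-u / t) • (k + t • coneAbs Q a) = m + (-u / t) • k := by
            match_scalars <;> field_simp
            ring
          rw [this]
          exact add_mem hm (Submodule.smul_mem _ _ hk)
      · exact (hside a ha).imp (fun h x hx hxH => h x ⟨hVa ▸ Submodule.mem_top, hx, hxH⟩)
          fun h x hx hxH => h x ⟨hVa ▸ Submodule.mem_top, hx, hxH⟩
    rcases hone with hone | hone
    · refine ⟨Q, hQ, fun x hx => ?_, fun _ => ⟨rfl, rfl, rfl⟩⟩
      by_cases hxH : x ∈ orderHyperplane Q a
      · exact (hSH x hx hxH).2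
      · exact hone x hx hxH
    · refine ⟨halfSpaceCone (orderHyperplane Q a) (hyperplaneCone Q a) (-coneAbs Q a), ?_,
        fun x hx => ?_, fun c => ?_⟩
      · rw [← hsup']
        exact isLinearConeOn_halfSpaceCone hP hb'
      · by_cases hxH : x ∈ orderHyperplane Q a
        · exact Or.inl (hSH x hx hxH)
        · obtain ⟨h, hh, s, rfl⟩ := hdec x
          have h1 := hone _ hx hxH
          rw [show -(h + s • coneAbs Q a) = -h + (-s) • coneAbs Q a by module,
            hmemQ (neg_mem hh)] at h1
          rcases h1 with h1 | ⟨h1, -⟩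
          · exact Or.inr ⟨h, hh, -s, h1, by module⟩
          · rw [neg_eq_zero.1 h1] at hxH
            exact absurd (by simpa using hh) hxH
      · have h1 := halfSpaceCone_congr hP hb hsup hb' hsup' c
        rwa [← hQeq] at h1
  · push Not at htop
    refine ⟨Q, hQ, fun x hx => ?_, fun _ => ⟨rfl, rfl, rfl⟩⟩
    rcases eq_or_ne x 0 with rfl | hx0
    · exact hQ.zero_mem
    obtain ⟨a, ha, hxa⟩ := hcover x hx0
    obtain ⟨y, hy⟩ : ∃ y, y ∉ orderSubspace Q a := by
      by_contra! h
      exact htop a ha (eq_top_iff.2 fun y _ => h y)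
    obtain ⟨b, hb, hyb⟩ := hcover y fun h => hy (h ▸ Submodule.zero_mem _)
    -- With no largest `V_a`, the point `x` lies in `H_b`, where the boundary condition gives its
    -- sign.
    exact (hB b hb ⟨hSC hx, hQ.orderSubspace_le_orderHyperplane hy hyb hxa⟩).1.2

end Converse

/-! ### Group orders and vector space orders. -/

section LinearOrderExtension

variable {G : Type*} [AddCommGroup G] [PartialOrder G] {r : G → G → Prop}

namespace IsLinearOrderExtension

variable (hr : IsLinearOrderExtension r)
include hr

theorem iff_zero_sub {g h : G} : r g h ↔ r 0 (h - g) := by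
  constructor <;> intro H
  · simpa [sub_eq_add_neg] using hr.add_right _ _ (-g) H
  · simpa using hr.add_right _ _ g H

theorem zero_add {g h : G} (hg : r 0 g) (hh : r 0 h) : r 0 (g + h) :=
  hr.trans _ _ _ hh (by simpa using hr.add_right _ _ h hg)

theorem zero_nsmul {g : G} (hg : r 0 g) (n : ℕ) : r 0 (n • g) := by
  induction n with
  | zero => simpa using hr.refl 0
  | succ n ih => simpa [succ_nsmul] using hr.zero_add ih hg

theorem zero_sum {ι : Type*} (s : Finset ι) (g : ι → G) (hg : ∀ i ∈ s, r 0 (g i)) :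
    r 0 (∑ i ∈ s, g i) :=
  Finset.sum_induction g (r 0) (fun _ _ => hr.zero_add) (hr.refl 0) hg

theorem eq_zero_of_sum_nsmul_eq_zero [IsAddTorsionFree G] {ι : Type*} {s : Finset ι} {g : ι → G}
    {n : ι → ℕ} (hg : ∀ i ∈ s, r 0 (g i)) (hn : ∀ i ∈ s, 0 < n i) (h : ∑ i ∈ s, n i • g i = 0) :
    ∀ i ∈ s, g i = 0 := by
  classical
  intro i hi
  rw [← Finset.add_sum_erase s _ hi] at h
  have h1 := hr.zero_nsmul (hg i hi) (n i)
  have h2 := hr.zero_sum (s.erase i) (fun j => n j • g j)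
    fun j hj => hr.zero_nsmul (hg j (Finset.mem_of_mem_erase hj)) _
  -- Each term is the negative of the sum of the others, hence both nonnegative and nonpositive.
  have h3 : r (n i • g i) 0 := by
    rw [hr.iff_zero_sub, _root_.zero_sub]
    rwa [← neg_eq_of_add_eq_zero_right h] at h2
  exact (nsmul_eq_zero_iff_right (hn i hi).ne').1 (hr.antisymm _ _ h3 h1)

theorem exists_isLinearConeOn [IsAddTorsionFree G] {E : Set G} (hE : IsMaximalIndependent E) :
    ∃ Q : Set (E →₀ ℝ), IsLinearConeOn ⊤ Q ∧
      ∀ g h, r g h ↔ realEmbedding hE h - realEmbedding hE g ∈ Q := by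
  classical
  obtain ⟨Q, hQ, hsub⟩ := exists_isLinearConeOn_top_of_salient
    (PointedCone.hull ℝ (realEmbedding hE '' {g | r 0 g})) (by
      intro x hx hx'
      obtain ⟨c, hc, hc0, rfl⟩ := PointedCone.mem_hull_set.1 hx
      obtain ⟨d, hd, hd0, hdx⟩ := PointedCone.mem_hull_set.1 hx'
      have hpre : ∀ y : E →₀ ℝ, ∃ g : G, y ∈ c.support ∪ d.support →
          r 0 g ∧ realEmbedding hE g = y := by
        intro y
        by_cases hy : y ∈ c.support ∪ d.support
        · have hy' : y ∈ realEmbedding hE '' {g | r 0 g} := by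
            rcases Finset.mem_union.1 hy with h | h
            · exact hc h
            · exact hd h
          obtain ⟨g, hg, hgy⟩ := hy'
          exact ⟨g, fun _ => ⟨hg, hgy⟩⟩
        · exact ⟨0, fun h => absurd h hy⟩
      choose g hg using hpre
      -- Adding the conic combinations for `x` and `-x` gives a relation whose coefficients are
      -- strictly positive on the union of the supports.
      obtain ⟨n, hn, hsum⟩ := exists_nat_relation (c.support ∪ d.support) (fun y => c y + d y)
        (fun y hy => by
          rcases Finset.mem_union.1 hy with h | h
          · exact add_pos_of_pos_of_nonneg
              ((hc0 y).lt_of_ne (Finsupp.mem_support_iff.1 h).symm) (hd0 y)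
          · exact add_pos_of_nonneg_of_pos (hc0 y)
              ((hd0 y).lt_of_ne (Finsupp.mem_support_iff.1 h).symm))
        (fun y => ratEmbedding hE (g y)) (by
          calc ∑ y ∈ c.support ∪ d.support, (c y + d y) • ratToReal (ratEmbedding hE (g y))
              = ∑ y ∈ c.support ∪ d.support, (c y • y + d y • y) := by
                refine Finset.sum_congr rfl fun y hy => ?_
                rw [← add_smul]
                exact congrArg _ (hg y hy).2
            _ = (c.sum fun m r => r • m) + d.sum fun m r => r • m := by
                rw [Finset.sum_add_distrib,
                  Finsupp.sum_of_support_subset c Finset.subset_union_left _ (by simp),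
                  Finsupp.sum_of_support_subset d Finset.subset_union_right _ (by simp)]
            _ = 0 := by rw [hdx, add_neg_cancel])
      have hsum' : ∑ y ∈ c.support ∪ d.support, n y • g y = 0 := by
        apply ratEmbedding_eq_zero hE
        change ratEmbeddingHom hE _ = 0
        rw [map_sum, ← hsum]
        exact Finset.sum_congr rfl fun y _ => map_nsmul _ _ _
      have hzero := hr.eq_zero_of_sum_nsmul_eq_zero (fun y hy => (hg y hy).1) hn hsum'
      refine Finset.sum_eq_zero fun y hy => ?_
      have hy' := Finset.mem_union_left d.support hy
      have hy0 : y = 0 := by rw [← (hg y hy').2, hzero y hy', realEmbedding_zero]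
      simp [hy0])
  have hpos : ∀ g, r 0 g → realEmbedding hE g ∈ Q := fun g hg =>
    hsub (Submodule.subset_span ⟨g, hg, rfl⟩)
  refine ⟨Q, hQ, fun g h => ?_⟩
  rw [← realEmbedding_sub, hr.iff_zero_sub]
  refine ⟨hpos _, fun hmem => ?_⟩
  rcases hr.total 0 (h - g) with h1 | h1
  · exact h1
  · rw [hr.iff_zero_sub, _root_.zero_sub] at h1
    have h2 := hpos _ h1
    rw [← _root_.zero_sub, realEmbedding_sub, realEmbedding_zero, _root_.zero_sub] at h2
    rw [(realEmbedding_eq_zero hE).1 (hQ.pure _ hmem h2)]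
    exact hr.refl 0

end IsLinearOrderExtension

theorem isGeneratingSet_ne_zero {ι : Type*} {Q : Set (ι →₀ ℝ)} (hQ : IsLinearConeOn ⊤ Q) :
    IsGeneratingSet Q {a : ι →₀ ℚ | a ≠ 0} where
  ne_zero _ ha := ha
  cover x hx := by
    let e : ι → ι →₀ ℝ := fun i => Finsupp.single i 1
    have hmono : ∀ a b : ι →₀ ℝ, coneAbs Q b - coneAbs Q a ∈ Q →
        orderSubspace Q a ≤ orderSubspace Q b := by
      intro a b hab
      refine Submodule.span_mono fun y hy => ⟨hy.1, ?_⟩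
      convert hQ.add_mem _ hab _ hy.2 using 1
      module
    -- The spaces of the unit vectors form a chain, so the largest one over the support of `x`
    -- contains `x`.
    have key : ∀ s : Finset ι, s.Nonempty → ∃ j ∈ s, ∀ i ∈ s,
        orderSubspace Q (e i) ≤ orderSubspace Q (e j) := by
      intro s hs
      induction hs using Finset.Nonempty.cons_induction with
      | singleton i => exact ⟨i, by simp, by simp⟩
      | cons i s hi _ ih =>
        obtain ⟨j, hj, hmax⟩ := ih
        rcases hQ.total (coneAbs Q (e j) - coneAbs Q (e i)) trivial with h | h
        · refine ⟨j, Finset.mem_cons_of_mem hj, fun k hk => ?_⟩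
          rcases Finset.mem_cons.1 hk with rfl | hk
          · exact hmono _ _ h
          · exact hmax k hk
        · rw [neg_sub] at h
          refine ⟨i, Finset.mem_cons_self i s, fun k hk => ?_⟩
          rcases Finset.mem_cons.1 hk with rfl | hk
          · exact le_rfl
          · exact (hmax k hk).trans (hmono _ _ h)
    obtain ⟨j, -, hmax⟩ := key x.support (Finsupp.support_nonempty_iff.2 hx)
    refine ⟨Finsupp.single j 1, by simp, ?_⟩
    have hej : ratToReal (Finsupp.single j 1) = e j := by simp [ratToReal, e]
    rw [hej]
    have hself : ∀ a : ι →₀ ℝ, a ∈ orderSubspace Q a := by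
      intro a
      have h := hQ.coneAbs_mem_orderSubspace a
      nth_rw 1 [coneAbs] at h
      split_ifs at h
      · exact h
      · exact neg_mem_iff.1 h
    rw [← Finsupp.sum_single x]
    refine Submodule.sum_mem _ fun i hi => ?_
    have : Finsupp.single i (x i) = x i • e i := by simp [e]
    rw [this]
    exact Submodule.smul_mem _ _ (hmax i hi (hself _))

variable {E : Set G} (hE : IsMaximalIndependent E)
include hE

theorem zero_mem_positiveImage : (0 : E →₀ ℝ) ∈ positiveImage hE :=
  ⟨0, le_refl (0 : G), realEmbedding_zero hE⟩

variable [IsOrderedAddMonoid G]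

theorem add_mem_positiveImage {x y : E →₀ ℝ} (hx : x ∈ positiveImage hE)
    (hy : y ∈ positiveImage hE) : x + y ∈ positiveImage hE := by
  obtain ⟨g, hg, rfl⟩ := hx
  obtain ⟨h, hh, rfl⟩ := hy
  exact ⟨g + h, add_nonneg hg hh, map_add (realEmbeddingHom hE) g h⟩

theorem isLinearOrderExtension_of_isLinearConeOn [IsAddTorsionFree G] {Q : Set (E →₀ ℝ)}
    (hQ : IsLinearConeOn ⊤ Q) (hsub : positiveImage hE ⊆ Q) :
    IsLinearOrderExtension fun g h => realEmbedding hE h - realEmbedding hE g ∈ Q where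
  refl g := by simpa using hQ.zero_mem
  trans x y z hxy hyz := by
    convert hQ.add_mem _ hxy _ hyz using 1
    module
  antisymm x y hxy hyx := by
    have h := hQ.pure _ hxy (by simpa using hyx)
    rw [← realEmbedding_sub, realEmbedding_eq_zero] at h
    exact (sub_eq_zero.1 h).symm
  total x y := by simpa using hQ.total (realEmbedding hE y - realEmbedding hE x) trivial
  add_right x y z h := by
    rw [← realEmbedding_sub] at h ⊢
    simpa using h
  extends_le x y h := by
    rw [← realEmbedding_sub]
    exact hsub ⟨y - x, sub_nonneg.2 h, rfl⟩

end LinearOrderExtension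

/-! ### The main theorem. -/

theorem theorem28 {G : Type*} [AddCommGroup G] [PartialOrder G] [IsOrderedAddMonoid G]
    [IsAddTorsionFree G] (E : Set G) (hE : IsMaximalIndependent E) :
    -- every linear order extension `r` comes from a set `U` of rational vectors and the linearly
    -- ordered hyperplanes `H_a`, `a ∈ U`, of a linear order (positive cone `Q`) on `⨁_E ℝ`
    (∀ r : G → G → Prop, IsLinearOrderExtension r →
      ∃ (Q : Set (E →₀ ℝ)) (U : Set (E →₀ ℚ)),
        IsLinearConeOn ⊤ Q ∧ IsGeneratingSet Q U ∧
        ∀ g h, r g h ↔ realEmbedding hE h - realEmbedding hE g ∈ Q) ∧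
    -- every such description has the following properties
    (∀ r : G → G → Prop, IsLinearOrderExtension r →
      ∀ (Q : Set (E →₀ ℝ)) (U : Set (E →₀ ℚ)),
        IsLinearConeOn ⊤ Q → IsGeneratingSet Q U →
        (∀ g h, r g h ↔ realEmbedding hE h - realEmbedding hE g ∈ Q) →
        -- `r` is determined by the linearly ordered hyperplanes and the signs of the `a ∈ U`
        (∀ g h, r g h ↔ g = h ∨ ∃ a ∈ U, realEmbedding hE h - realEmbedding hE g ∈
          halfSpaceCone (orderHyperplane Q (ratToReal a)) (hyperplaneCone Q (ratToReal a))
            (coneAbs Q (ratToReal a))) ∧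
        ∀ a ∈ U,
          -- `H_a` is a hyperplane of `V_a`, namely `V_a = H_a ⊕ ℝ a`, and is linearly ordered
          ratToReal a ∉ orderHyperplane Q (ratToReal a) ∧
          orderHyperplane Q (ratToReal a) ⊔ Submodule.span ℝ {ratToReal a} =
            orderSubspace Q (ratToReal a) ∧
          IsLinearConeOn (orderHyperplane Q (ratToReal a)) (hyperplaneCone Q (ratToReal a)) ∧
          -- the positive cone of `V_a`
          (orderSubspace Q (ratToReal a) : Set (E →₀ ℝ)) ∩ Q =
            halfSpaceCone (orderHyperplane Q (ratToReal a)) (hyperplaneCone Q (ratToReal a))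
              (coneAbs Q (ratToReal a)) ∧
          -- `conv(φ[G_+]) ∩ H_a ⊆ (H_a)_+ ∩ ∂ conv(φ[G_+])`
          BoundaryCondition (positiveHull hE) Q (ratToReal a) ∧
          -- the number of linear order extensions on `V_a` defined by `H_a`
          ((partOffHyperplane (positiveImage hE) Q (ratToReal a)).Nonempty →
            numExtensions (positiveHull hE) Q (ratToReal a) = 1) ∧
          (¬ (partOffHyperplane (positiveImage hE) Q (ratToReal a)).Nonempty →
            numExtensions (positiveHull hE) Q (ratToReal a) = 2)) ∧
    -- conversely, linearly ordered hyperplanes satisfying the boundary condition define a linear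
    -- order extension, if the cone has an interior point or lies on one side of each hyperplane
    (∀ (Q : Set (E →₀ ℝ)) (U : Set (E →₀ ℚ)),
      IsLinearConeOn ⊤ Q → IsGeneratingSet Q U →
      (∀ a ∈ U, BoundaryCondition (positiveHull hE) Q (ratToReal a)) →
      ((lineInterior (positiveHull hE)).Nonempty ∨
        ∀ a ∈ U,
          (∀ x ∈ partOffHyperplane (positiveImage hE) Q (ratToReal a), x ∈ Q) ∨
          (∀ x ∈ partOffHyperplane (positiveImage hE) Q (ratToReal a), -x ∈ Q)) →
      ∃ Q' : Set (E →₀ ℝ),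
        IsLinearConeOn ⊤ Q' ∧
        IsLinearOrderExtension
          (fun g h => realEmbedding hE h - realEmbedding hE g ∈ Q') ∧
        ∀ a ∈ U,
          orderSubspace Q' (ratToReal a) = orderSubspace Q (ratToReal a) ∧
          orderHyperplane Q' (ratToReal a) = orderHyperplane Q (ratToReal a) ∧
          hyperplaneCone Q' (ratToReal a) = hyperplaneCone Q (ratToReal a)) := by
  refine ⟨fun r hr => ?_, fun r hr Q U hQ hU hrQ => ?_, fun Q U hQ hU hB hside => ?_⟩
  · obtain ⟨Q, hQ, hrQ⟩ := hr.exists_isLinearConeOn hE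
    exact ⟨Q, _, hQ, isGeneratingSet_ne_zero hQ, hrQ⟩
  · have hne : ∀ a ∈ U, ratToReal a ≠ 0 := fun a ha h =>
      hU.ne_zero a ha (ratToReal_eq_zero.1 h)
    have hsub : positiveImage hE ⊆ Q := by
      rintro _ ⟨g, hg, rfl⟩
      simpa [realEmbedding_zero] using (hrQ 0 g).1 (hr.extends_le _ _ hg)
    have hhull : positiveHull hE ⊆ Q := convexHull_min hsub hQ.convex
    refine ⟨fun g h => ?_, fun a ha => ⟨?_, ?_, hQ.isLinearConeOn_hyperplaneCone _,
      hQ.orderSubspace_inter_eq_halfSpaceCone (hne a ha), hQ.boundaryCondition hhull (hne a ha),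
      hQ.numExtensions_eq_one hsub (hne a ha), hQ.numExtensions_eq_two hsub (hne a ha)⟩⟩
    · constructor
      · intro hgh
        by_cases heq : g = h
        · exact Or.inl heq
        right
        have hx : realEmbedding hE h - realEmbedding hE g ≠ 0 := by
          rw [← realEmbedding_sub, Ne, realEmbedding_eq_zero, sub_eq_zero]
          exact fun h => heq h.symm
        obtain ⟨a, ha, hxa⟩ := hU.cover _ hx
        refine ⟨a, ha, ?_⟩
        rw [← hQ.orderSubspace_inter_eq_halfSpaceCone (hne a ha)]
        exact ⟨hxa, (hrQ g h).1 hgh⟩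
      · rintro (rfl | ⟨a, ha, hx⟩)
        · exact hr.refl g
        · rw [← hQ.orderSubspace_inter_eq_halfSpaceCone (hne a ha)] at hx
          exact (hrQ g h).2 hx.2
    · intro h
      exact hQ.coneAbs_notMem_orderHyperplane (hne a ha) (coneAbs_mem_submodule h Q)
    · rw [← IsLinearConeOn.span_coneAbs (Q := Q),
        hQ.orderHyperplane_sup_span_coneAbs (hne a ha)]
  · obtain ⟨Q', hQ', hsub, hsame⟩ := exists_isLinearConeOn_of_boundaryCondition hQ
      (A := ratToReal '' U) (S := positiveImage hE)
      (by
        rintro _ ⟨a, ha, rfl⟩ h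
        exact hU.ne_zero a ha (ratToReal_eq_zero.1 h))
      (fun x hx => by simpa using hU.cover x hx)
      (fun _ hx _ hy => add_mem_positiveImage hE hx hy) (zero_mem_positiveImage hE)
      (by
        rintro _ ⟨a, ha, rfl⟩
        exact hB a ha)
      (hside.imp_right (by
        rintro h _ ⟨a, ha, rfl⟩
        exact h a ha))
    exact ⟨Q', hQ', isLinearOrderExtension_of_isLinearConeOn hE hQ' hsub, fun a _ => hsame _⟩
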